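/- Let $M$ be a finite set of indivisible items and let $[n]=\{1,\dots,n\}$, $n\ge 2$, be the set of agents. A valuation is a function $f:2^M\to\mathbb R$ with $f(\emptyset)=0$ and $f(S)\le f(T)$ for $S\subseteq T$; it is dichotomous if $f(S\cup\{a\})-f(S)\in\{0,1\}$ for all $S\subseteq M$, $a\in M$, submodular if $f(T\cup\{a\})-f(T)\le f(S\cup\{a\})-f(S)$ for all $S\subseteq T\subseteq M$, $a\in M$, and additive if $f(S)+f(T)=f(S\cup T)$ for disjoint $S,T$. An allocation is a tuple $A=(A_1,\dots,A_n)$ of pairwise disjoint subsets of $M$ (items may stay unallocated). Given valuations $f=(f_1,\dots,f_n)$, $A$ is non-redundant if $f_i(A_i\setminus\{a\})<f_i(A_i)$ for all $i$ and $a\in A_i$, and $A$ is Lorenz dominating if for every allocation $B$ and every $k\in[n]$ the sum of the $k$ smallest entries of $(f_i(A_i))_i$ is at least the sum of the $k$ smallest entries of $(f_i(B_i))_i$. A prioritized egalitarian (PE) mechanism with priority order $\sigma$ (a permutation of $[n]$; $\sigma(i)$ is the position of agent $i$, and position $1$ is the highest priority) asks every agent to report a valuation, replaces every missing report and every report that is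 not a submodular dichotomous valuation by the zero valuation, and, for the resulting valuations $r=(r_1,\dots,r_n)$, outputs a non-redundant allocation that is obtained as follows. Add auxiliary items $a_1,\dots,a_n$, and let $r'_i(S)=r_i(S\cap M)+\frac{\sigma(i)}{n^2}\,|S\cap\{a_i\}|$ for $S\subseteq M\cup\{a_1,\dots,a_n\}$; take a Lorenz dominating allocation for $r'_1,\dots,r'_n$ and remove the auxiliary items. The random priority egalitarian (RPE) mechanism draws $\sigma$ uniformly at random and runs a PE mechanism with priority order $\sigma$. **Theorem.** For every $\sigma$ and all reports the PE mechanism is well defined, that is, a non-redundant allocation as above exists. Moreover, whichever of these allocations the PE mechanisms select, the RPE mechanism has the following properties. 1. (Universal truthfulness.) For every realization of $\sigma$, every agent $i$ with a submodular dichotomous valuation $f_i$, and all reports of the other agents, agent $i$ maximizes the value $f_i(A_i)$ of the bundle that she receives by reporting $f_i$. Suppose now that the agents have submodular dichotomous valuations $f_1,\dots,f_n$ and report them truthfully. 2. Every realized allocation $A$ maximizes the welfare $\sum_i f_i(A_i)$ among all allocations. 3. Every realized allocation $A$ is Lorenz dominating, maximizes the Nash social welfare $\prod_i f_i(A_i)$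 among all allocations, and is envy-free up to any item (EFX): for all $i,j$, either $f_i(A_i)\ge f_i(A_j)$, or $f_i(A_i)\ge f_i(A_j\setminus\{e\})$ for every $e\in A_j$. If moreover all $f_i$ are additive, then every agent $i$ gets at least her maximin share: $f_i(A_i)\ge\max\min_{j\in[n]}f_i(S_j)$, where the maximum is over all partitions of $M$ into $n$ (possibly empty) bundles $S_1,\dots,S_n$. 4. The random allocation $A$ is stochastically envy-free: $\Pr[f_i(A_i)\ge t]\ge\Pr[f_i(A_j)\ge t]$ for all agents $i,j$ and all $t\in\mathbb R$. Hence it is ex-ante envy-free, $\mathbb E[f_i(A_i)]\ge\mathbb E[f_i(A_j)]$ for all $i,j$, and ex-ante proportional, $\mathbb E[f_i(A_i)]\ge\frac1n f_i(M)$ for all $i$. -/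

import Mathlib

namespace FairDivision

/-! ### Valuations -/

section Valuations

variable {M : Type*} [DecidableEq M]

/-- A valuation function: normalized and non-decreasing. -/
structure IsValuation (f : Finset M → ℝ) : Prop where
  normalized : f ∅ = 0
  mono : ∀ S T : Finset M, S ⊆ T → f S ≤ f T

/-- Every marginal value is `0` or `1`. -/
def IsDichotomous (f : Finset M → ℝ) : Prop :=
  ∀ (S : Finset M) (a : M), f (S ∪ {a}) - f S = 0 ∨ f (S ∪ {a}) - f S = 1

/-- Decreasing marginal values. -/
def IsSubmodular (f : Finset M → ℝ) : Prop :=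
  ∀ S T : Finset M, S ⊆ T → ∀ a : M, f (T ∪ {a}) - f T ≤ f (S ∪ {a}) - f S

def IsAdditive (f : Finset M → ℝ) : Prop :=
  ∀ S T : Finset M, Disjoint S T → f S + f T = f (S ∪ T)

/-- Submodular dichotomous valuations (equivalently, matroid rank functions). -/
structure IsSubmodularDichotomous (f : Finset M → ℝ) : Prop where
  valuation : IsValuation f
  dichotomous : IsDichotomous f
  submodular : IsSubmodular f

end Valuations

/-! ### Allocations -/

/-- An allocation of indivisible items to the agents `0, …, n - 1`; items may stay unallocated. -/
@[ext]
structure Allocation (n : ℕ) (M : Type*) where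
  bundle : Fin n → Finset M
  disjoint : ∀ i j : Fin n, i ≠ j → Disjoint (bundle i) (bundle j)

noncomputable instance Allocation.instFintype {n : ℕ} {M : Type*} [Fintype M] :
    Fintype (Allocation n M) := by
  classical
  exact Fintype.ofInjective Allocation.bundle fun _ _ h => Allocation.ext h

section Fairness

variable {n : ℕ} {M : Type*}

/-- The utility vector of an allocation. -/
def utility (f : Fin n → Finset M → ℝ) (A : Allocation n M) : Fin n → ℝ :=
  fun i => f i (A.bundle i)

def IsWelfareMaximizing (f : Fin n → Finset M → ℝ) (A : Allocation n M) : Prop :=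
  ∀ B : Allocation n M, ∑ i, utility f B i ≤ ∑ i, utility f A i

/-- No item can be taken away from a bundle without a loss of value for its owner. -/
def IsNonRedundant [DecidableEq M] (f : Fin n → Finset M → ℝ) (A : Allocation n M) : Prop :=
  ∀ i : Fin n, ∀ a ∈ A.bundle i, f i (A.bundle i \ {a}) < f i (A.bundle i)

/-- The entries of `u`, sorted from smallest to largest. -/
noncomputable def sortedVector (u : Fin n → ℝ) : Fin n → ℝ := u ∘ Tuple.sort u

/-- `u ≥ w` in the Lorenz order: for every `k`, the sum of the `k` smallest entries of `u` is at
least the sum of the `k` smallest entries of `w`. -/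
def LorenzGE (u w : Fin n → ℝ) : Prop :=
  ∀ k : Fin n, ∑ j ∈ Finset.Iic k, sortedVector w j ≤ ∑ j ∈ Finset.Iic k, sortedVector u j

def IsLorenzDominating (f : Fin n → Finset M → ℝ) (A : Allocation n M) : Prop :=
  ∀ B : Allocation n M, LorenzGE (utility f A) (utility f B)

/-- `A` maximizes the Nash social welfare. -/
def IsNSWMaximizing (f : Fin n → Finset M → ℝ) (A : Allocation n M) : Prop :=
  ∀ B : Allocation n M, ∏ i, utility f B i ≤ ∏ i, utility f A i

/-- Envy-free up to any good. -/
def IsEFX [DecidableEq M] (f : Fin n → Finset M → ℝ) (A : Allocation n M) : Prop :=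
  ∀ i j : Fin n, f i (A.bundle j) ≤ f i (A.bundle i) ∨
    ∀ e ∈ A.bundle j, f i (A.bundle j \ {e}) ≤ f i (A.bundle i)

/-- All items are allocated: the bundles partition the items. -/
def Allocation.IsPartition (A : Allocation n M) : Prop := ∀ a : M, ∃ i : Fin n, a ∈ A.bundle i

/-- The maximin share for `n` agents of an agent with valuation `g`. For `1 ≤ n` and finitely many
items, supremum and infimum are over nonempty finite families, hence a maximum and a minimum. -/
noncomputable def maximinShare (n : ℕ) (g : Finset M → ℝ) : ℝ :=
  ⨆ P : {P : Allocation n M // P.IsPartition}, ⨅ j : Fin n, g (P.1.bundle j)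

def IsMaximinFair (f : Fin n → Finset M → ℝ) (A : Allocation n M) : Prop :=
  ∀ i : Fin n, maximinShare n (f i) ≤ f i (A.bundle i)

end Fairness

/-! ### Distributions over allocations -/

section Random

variable {n : ℕ} {M : Type*}

/-- The expected value of `X` under a distribution `μ` over allocations. -/
noncomputable def expectation [Fintype M] (μ : PMF (Allocation n M)) (X : Allocation n M → ℝ) : ℝ :=
  ∑ A : Allocation n M, (μ A).toReal * X A

def IsStochasticallyEnvyFree (f : Fin n → Finset M → ℝ) (μ : PMF (Allocation n M)) : Prop :=
  ∀ (i j : Fin n) (t : ℝ),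
    μ.toOuterMeasure {A | t ≤ f i (A.bundle j)} ≤ μ.toOuterMeasure {A | t ≤ f i (A.bundle i)}

def IsExAnteEnvyFree [Fintype M] (f : Fin n → Finset M → ℝ) (μ : PMF (Allocation n M)) : Prop :=
  ∀ i j : Fin n,
    expectation μ (fun A => f i (A.bundle j)) ≤ expectation μ (fun A => f i (A.bundle i))

def IsExAnteProportional [Fintype M] (f : Fin n → Finset M → ℝ) (μ : PMF (Allocation n M)) :
    Prop :=
  ∀ i : Fin n, f i Finset.univ / n ≤ expectation μ (fun A => f i (A.bundle i))

end Random

/-! ### Mechanisms -/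

section Mechanisms

variable {n : ℕ} {M : Type*}

/-- What an agent may tell the mechanism: any function on sets of items, or nothing at all. -/
abbrev Report (M : Type*) := Option (Finset M → ℝ)

abbrev Mechanism (n : ℕ) (M : Type*) := (Fin n → Report M) → Allocation n M

open Classical in
/-- The valuation that the mechanism works with: a missing report, or one that is not submodular
dichotomous, is replaced by the zero valuation. -/
noncomputable def legalized [DecidableEq M] (r : Report M) : Finset M → ℝ :=
  match r with
  | none => 0
  | some g => if IsSubmodularDichotomous g then g else 0

/-- For every agent with a submodular dichotomous valuation `g`, reporting `g` is a dominant
strategy, whatever (possibly illegal) reports the other agents make. -/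
def Mechanism.IsTruthful [DecidableEq M] (mech : Mechanism n M) : Prop :=
  ∀ (i : Fin n) (g : Finset M → ℝ), IsSubmodularDichotomous g → ∀ r : Fin n → Report M,
    g ((mech r).bundle i) ≤ g ((mech (Function.update r i (some g))).bundle i)

/-- The valuations in the instance that has, besides the items `M`, one auxiliary item `a_i` for
each agent `i`, where `a_i` adds `p / n ^ 2` to the value of agent `i` alone. Here
`p = σ i + 1 ∈ {1, …, n}` is the position of `i` in the priority order `σ`; position `1` is the
highest priority. -/
noncomputable def augmented (σ : Equiv.Perm (Fin n)) (f : Fin n → Finset M → ℝ) :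
    Fin n → Finset (M ⊕ Fin n) → ℝ :=
  fun i S => f i S.toLeft + if i ∈ S.toRight then (((σ i : ℕ) : ℝ) + 1) / (n : ℝ) ^ 2 else 0

/-- Remove the auxiliary items. -/
def Allocation.removeAux (A : Allocation n (M ⊕ Fin n)) : Allocation n M where
  bundle i := (A.bundle i).toLeft
  disjoint i j hij := by
    rw [Finset.disjoint_left]
    intro a hi hj
    rw [Finset.mem_toLeft] at hi hj
    exact Finset.disjoint_left.mp (A.disjoint i j hij) hi hj

/-- `A` is a possible outcome of the prioritized egalitarian rule with priority order `σ` at the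
valuations `f`: it is non-redundant, and it results from a Lorenz dominating allocation of the
augmented instance by removing the auxiliary items. -/
def IsPEAllocation [DecidableEq M] (σ : Equiv.Perm (Fin n)) (f : Fin n → Finset M → ℝ)
    (A : Allocation n M) : Prop :=
  IsNonRedundant f A ∧
    ∃ A' : Allocation n (M ⊕ Fin n), IsLorenzDominating (augmented σ f) A' ∧ A'.removeAux = A

/-- `mech` is a prioritized egalitarian (PE) mechanism with priority order `σ`. -/
def IsPEMechanism [DecidableEq M] (σ : Equiv.Perm (Fin n)) (mech : Mechanism n M) : Prop :=
  ∀ r : Fin n → Report M, IsPEAllocation σ (fun i => legalized (r i)) (mech r)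

/-- The random priority egalitarian (RPE) mechanism: draw a uniformly random priority order `σ`
and run the PE mechanism `PE σ` on the reports. The result is the distribution of its outcome. -/
noncomputable def randomPriority (PE : Equiv.Perm (Fin n) → Mechanism n M)
    (r : Fin n → Report M) : PMF (Allocation n M) :=
  (PMF.uniformOfFintype (Equiv.Perm (Fin n))).map fun σ => PE σ r

end Mechanisms

end FairDivision

open FairDivision

/-! The utility vectors of non-redundant allocations, which are also their vectors of bundle sizes,
are the integral points of a polymatroid. All that is needed about them is one exchange property
(`exists_exchange`): if `x i < y i`, then `x` allows one more unit for `i`, possibly at the expense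
of one unit of an agent `j` with `x j > y j`.

Write `ε i` for the value of the auxiliary item of agent `i`. A feasible vector `x` is called
optimal (`IsOptimal`) if no coordinate can be increased and no transfer of a unit makes `x + ε` more
equal. By the exchange property, every feasible vector is joined to an optimal one by increments and
equalizing transfers, so an optimal vector maximizes every function that such moves do not decrease
(`IsOptimal.apply_le`). Lorenz domination is equivalent to an inequality for all the functions `u ↦
-∑ i, max (c - u i) 0` (`lorenzGE_iff_forall_hinge`), which are of this kind; hence the outcomes of
the PE rule are exactly the non-redundant allocations with optimal size vector
(`IsPEAllocation.isOptimal`, `IsOptimal.isPEAllocation`). As the offsets differ by less than `1`,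
such a vector is also optimal without offsets, and this gives maximal welfare, Lorenz domination,
maximal Nash welfare, the EFX property and the maximin share guarantee.

Think of the `a`-th unit of agent `k` as a slot at level `a + ε k`. For every initial segment of the
slots, an optimal vector fills as many slots of the segment as possible (`IsOptimal.sum_min_le`), as
the greedy algorithm does. Counting filled slots shows that a false report cannot gain a slot
(`IsOptimal.apply_bundle_le`), and it shows how the outcome changes when two agents `i` and `j`
change places in the priority order (`IsOptimal.swap`). By the latter, the values for `i` of her own
bundle under two such priority orders dominate those of the bundle of `j`; summing over all pairs of
orders yields stochastic envy-freeness. Proportionality in expectation follows, since the bundles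
together have the value of all items for every agent (`IsOptimal.apply_univ_le_sum`). -/

namespace FairDivision

open Finset

/-! ### Rank functions -/

section Rank

variable {M : Type*} [DecidableEq M] {f : Finset M → ℝ}

namespace IsSubmodularDichotomous

lemma union_singleton_eq (hf : IsSubmodularDichotomous f) (S : Finset M) (a : M) :
    f (S ∪ {a}) = f S ∨ f (S ∪ {a}) = f S + 1 := by
  rcases hf.dichotomous S a with h | h
  · left; linarith
  · right; linarith

lemma union_le (hf : IsSubmodularDichotomous f) (S T : Finset M) : f (S ∪ T) ≤ f S + #T := by
  induction T using Finset.induction_on with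
  | empty => simp
  | insert a T ha ih =>
    rw [card_insert_of_notMem ha, insert_eq, union_comm {a} T, ← union_assoc]
    push_cast
    rcases hf.union_singleton_eq (S ∪ T) a with h | h <;> rw [h] <;> linarith

lemma le_card (hf : IsSubmodularDichotomous f) (S : Finset M) : f S ≤ #S := by
  have := hf.union_le ∅ S
  rwa [hf.valuation.normalized, empty_union, zero_add] at this

/-- Every set contains an independent set, that is, one whose value is its cardinality, of the same
value. -/
lemma exists_independent_subset (hf : IsSubmodularDichotomous f) (S : Finset M) :
    ∃ T ⊆ S, f T = f S ∧ (#T : ℝ) = f T := by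
  induction S using Finset.induction_on with
  | empty => exact ⟨∅, subset_rfl, rfl, by simp [hf.valuation.normalized]⟩
  | insert a S ha ih =>
    obtain ⟨T, hTS, hT, hcard⟩ := ih
    have haT : a ∉ T := fun h => ha (hTS h)
    have hle := hf.submodular T S hTS a
    have hS : S ∪ {a} = insert a S := by rw [insert_eq, union_comm]
    have hTa : T ∪ {a} = insert a T := by rw [insert_eq, union_comm]
    rw [hS] at hle
    rcases hf.union_singleton_eq S a with h | h <;> rw [hS] at h
    · exact ⟨T, hTS.trans (subset_insert a S), by rw [hT, h], hcard⟩
    · refine ⟨insert a T, insert_subset_insert a hTS, ?_, ?_⟩ <;>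
        rcases hf.union_singleton_eq T a with h' | h' <;> rw [hTa] at hle h' <;>
        try rw [card_insert_of_notMem haT]
      all_goals push_cast; linarith

lemma exists_nat (hf : IsSubmodularDichotomous f) (S : Finset M) : ∃ k : ℕ, f S = k := by
  obtain ⟨T, -, hT, hcard⟩ := hf.exists_independent_subset S
  exact ⟨#T, by rw [hcard, hT]⟩

lemma independent_subset (hf : IsSubmodularDichotomous f) {S T : Finset M} (hTS : T ⊆ S)
    (hS : f S = #S) : f T = #T := by
  have h := hf.union_le T (S \ T)
  rw [union_sdiff_of_subset hTS, hS, ← card_sdiff_add_card_eq_card hTS] at h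
  push_cast at h
  exact le_antisymm (hf.le_card T) (by linarith)

lemma union_eq_of_forall (hf : IsSubmodularDichotomous f) {S T : Finset M}
    (h : ∀ e ∈ T, f (S ∪ {e}) = f S) : f (S ∪ T) = f S := by
  induction T using Finset.induction_on with
  | empty => simp
  | insert a T _ ih =>
    have hT := ih fun e he => h e (mem_insert_of_mem he)
    have hle := hf.submodular S (S ∪ T) subset_union_left a
    have hge := hf.valuation.mono (S ∪ T) (S ∪ T ∪ {a}) subset_union_left
    rw [h a (mem_insert_self a T)] at hle
    rw [insert_eq, union_comm {a} T, ← union_assoc]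
    linarith

/-- The augmentation property of matroids. -/
lemma exists_augment (hf : IsSubmodularDichotomous f) {S T : Finset M} (h : f S < f T) :
    ∃ e ∈ T, f (S ∪ {e}) = f S + 1 := by
  by_contra! hne
  have := hf.union_eq_of_forall (S := S) (T := T) fun e he =>
    (hf.union_singleton_eq S e).resolve_right (hne e he)
  have := hf.valuation.mono T (S ∪ T) subset_union_right
  linarith

lemma union_le_add (hf : IsSubmodularDichotomous f) (S T : Finset M) :
    f (S ∪ T) ≤ f S + f T := by
  induction T using Finset.induction_on with
  | empty => simp [hf.valuation.normalized]
  | insert a T _ ih =>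
    have hle := hf.submodular T (S ∪ T) subset_union_right a
    rw [insert_eq, union_comm {a} T, ← union_assoc]
    linarith

lemma biUnion_le_sum (hf : IsSubmodularDichotomous f) {ι : Type*} [DecidableEq ι] (s : Finset ι)
    (A : ι → Finset M) : f (s.biUnion A) ≤ ∑ i ∈ s, f (A i) := by
  induction s using Finset.induction_on with
  | empty => simp [hf.valuation.normalized]
  | insert i s hi ih =>
    rw [biUnion_insert, sum_insert hi]
    exact (hf.union_le_add _ _).trans (by linarith)

lemma card_eq_of_nonRedundant (hf : IsSubmodularDichotomous f) {S : Finset M}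
    (h : ∀ a ∈ S, f (S \ {a}) < f S) : f S = #S := by
  obtain ⟨T, hTS, hT, hcard⟩ := hf.exists_independent_subset S
  obtain rfl : T = S := by
    refine hTS.antisymm fun a ha => ?_
    by_contra haT
    have := hf.valuation.mono T (S \ {a}) fun b hb =>
      mem_sdiff.2 ⟨hTS hb, by simpa using fun hba : b = a => haT (hba ▸ hb)⟩
    linarith [h a ha]
  exact hcard.symm

lemma sdiff_singleton_lt (hf : IsSubmodularDichotomous f) {S : Finset M} (h : f S = #S) {a : M}
    (ha : a ∈ S) : f (S \ {a}) < f S := by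
  rw [h]
  refine (hf.le_card _).trans_lt ?_
  exact_mod_cast card_lt_card (sdiff_ssubset (singleton_subset_iff.2 ha) (singleton_nonempty a))

end IsSubmodularDichotomous

lemma isSubmodularDichotomous_zero : IsSubmodularDichotomous (0 : Finset M → ℝ) :=
  ⟨⟨rfl, fun _ _ _ => le_rfl⟩, fun _ _ => by simp, fun _ _ _ _ => by simp⟩

lemma isSubmodularDichotomous_legalized (r : Report M) :
    IsSubmodularDichotomous (legalized r) := by
  unfold legalized
  split
  · exact isSubmodularDichotomous_zero
  · split_ifs with h
    · exact h
    · exact isSubmodularDichotomous_zero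

lemma legalized_some (hf : IsSubmodularDichotomous f) : legalized (some f) = f := if_pos hf

/-- The rank function of the matroid whose independent sets are the subsets of `S`. -/
lemma isSubmodularDichotomous_card_inter (S : Finset M) :
    IsSubmodularDichotomous fun T : Finset M => (#(T ∩ S) : ℝ) := by
  have key : ∀ (T : Finset M) (a : M),
      (#((T ∪ {a}) ∩ S) : ℝ) - #(T ∩ S) = if a ∈ S ∧ a ∉ T then 1 else 0 := by
    intro T a
    rw [union_comm, ← insert_eq]
    by_cases haS : a ∈ S
    · by_cases haT : a ∈ T
      · simp [haT]
      · rw [insert_inter_of_mem haS, card_insert_of_notMem (by simp [haT])]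
        simp [haS, haT]
    · rw [insert_inter_of_notMem haS]
      simp [haS]
  refine ⟨⟨by simp, fun T U h => ?_⟩, fun T a => ?_, fun T U h a => ?_⟩
  · exact_mod_cast card_le_card (inter_subset_inter_right h)
  · rw [key]; split_ifs <;> simp
  · rw [key, key]
    split_ifs with h₁ h₂ <;> try norm_num
    exact h₂ ⟨h₁.1, fun ha => h₁.2 (h ha)⟩

end Rank

/-! ### Size vectors of non-redundant allocations -/

section Feasible

variable {M : Type*} {n : ℕ} {f : Fin n → Finset M → ℝ}

/-- Every bundle of `A` is independent for its owner, and `x` is the vector of their values, which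
are at the same time their sizes. -/
def Realizes (f : Fin n → Finset M → ℝ) (A : Allocation n M) (x : Fin n → ℕ) : Prop :=
  ∀ i, f i (A.bundle i) = x i ∧ #(A.bundle i) = x i

/-- The vectors `x` that are utility vectors of non-redundant allocations. For submodular
dichotomous valuations they are the integral points of a polymatroid. -/
def Feasible (f : Fin n → Finset M → ℝ) (x : Fin n → ℕ) : Prop :=
  ∃ A : Allocation n M, Realizes f A x

/-- Shrink the bundles of an allocation. -/
def Allocation.shrink (A : Allocation n M) (B : Fin n → Finset M) (h : ∀ i, B i ⊆ A.bundle i) :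
    Allocation n M where
  bundle := B
  disjoint i j hij := (A.disjoint i j hij).mono (h i) (h j)

lemma finite_setOf_feasible [Fintype M] : {x | Feasible f x}.Finite :=
  (Set.finite_Iic fun _ => Fintype.card M).subset fun _ ⟨_, hA⟩ i =>
    (hA i).2.ge.trans (card_le_univ _)

variable [DecidableEq M]

/-- Give the item `e` to agent `k`, taking it away from its former owner, if any. -/
def Allocation.give (A : Allocation n M) (k : Fin n) (e : M) : Allocation n M where
  bundle l := if l = k then insert e (A.bundle l) else A.bundle l \ {e}
  disjoint i j hij := by
    rw [Finset.disjoint_left]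
    intro a hi hj
    have := A.disjoint i j hij
    rw [Finset.disjoint_left] at this
    have := @this a
    split_ifs at hi hj <;> simp_all

lemma Realizes.mono (hf : ∀ i, IsSubmodularDichotomous (f i)) {A B : Allocation n M}
    {x y : Fin n → ℕ} (hA : Realizes f A x) (hBA : ∀ i, B.bundle i ⊆ A.bundle i)
    (hB : ∀ i, #(B.bundle i) = y i) : Realizes f B y := fun i =>
  ⟨by rw [(hf i).independent_subset (hBA i) (by rw [(hA i).1, (hA i).2]), hB], hB i⟩

lemma Feasible.mono (hf : ∀ i, IsSubmodularDichotomous (f i)) {x y : Fin n → ℕ}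
    (hx : Feasible f x) (hyx : y ≤ x) : Feasible f y := by
  obtain ⟨A, hA⟩ := hx
  choose B hBA hB using fun i =>
    exists_subset_card_eq (s := A.bundle i) (n := y i) ((hyx i).trans (hA i).2.ge)
  exact ⟨A.shrink B hBA, hA.mono hf hBA hB⟩

lemma exists_feasible_utility_eq (hf : ∀ i, IsSubmodularDichotomous (f i))
    (A : Allocation n M) : ∃ x, Feasible f x ∧ ∀ i, utility f A i = x i := by
  choose B hBA hB hcard using fun i => (hf i).exists_independent_subset (A.bundle i)
  exact ⟨fun i => #(B i), ⟨A.shrink B hBA, fun i => ⟨(hcard i).symm, rfl⟩⟩,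
    fun i => ((hcard i).trans (hB i)).symm⟩

lemma IsNonRedundant.realizes (hf : ∀ i, IsSubmodularDichotomous (f i)) {A : Allocation n M}
    (hA : IsNonRedundant f A) : Realizes f A fun i => #(A.bundle i) :=
  fun i => ⟨(hf i).card_eq_of_nonRedundant (hA i), rfl⟩

lemma Realizes.isNonRedundant (hf : ∀ i, IsSubmodularDichotomous (f i)) {A : Allocation n M}
    {x : Fin n → ℕ} (hA : Realizes f A x) : IsNonRedundant f A := fun i _ ha =>
  (hf i).sdiff_singleton_lt (by rw [(hA i).1, (hA i).2]) ha

lemma feasible_zero (hf : ∀ i, IsSubmodularDichotomous (f i)) : Feasible f 0 :=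
  ⟨⟨fun _ => ∅, fun _ _ _ => disjoint_empty_left _⟩,
    fun i => ⟨by simp [(hf i).valuation.normalized], by simp⟩⟩

lemma Realizes.give_of_unallocated {A : Allocation n M} {x : Fin n → ℕ} (hA : Realizes f A x)
    {k : Fin n} {e : M} (hke : f k (A.bundle k ∪ {e}) = f k (A.bundle k) + 1)
    (he : ∀ j, e ∉ A.bundle j) : Realizes f (A.give k e) (x + Pi.single k 1) := by
  intro l
  by_cases hl : l = k
  · subst hl
    have h : (A.give l e).bundle l = insert e (A.bundle l) := by simp [Allocation.give]
    rw [h]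
    refine ⟨?_, by simp [card_insert_of_notMem (he l), (hA l).2]⟩
    rw [insert_eq, union_comm, hke, (hA l).1]
    simp
  · have h : (A.give k e).bundle l = A.bundle l := by simp [Allocation.give, hl, he l]
    rw [h]
    simpa [hl] using hA l

lemma notMem_of_marginal_eq_one {S : Finset M} {g : Finset M → ℝ} {e : M}
    (h : g (S ∪ {e}) = g S + 1) : e ∉ S := by
  intro he
  rw [union_eq_left.2 (singleton_subset_iff.2 he)] at h
  linarith

lemma Realizes.give_of_mem (hf : ∀ i, IsSubmodularDichotomous (f i)) {A : Allocation n M}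
    {x : Fin n → ℕ} (hA : Realizes f A x) {j k : Fin n} {e : M}
    (hke : f k (A.bundle k ∪ {e}) = f k (A.bundle k) + 1) (he : e ∈ A.bundle j) :
    j ≠ k ∧ ∃ v : Fin n → ℕ, x = v + Pi.single j 1 ∧
      Realizes f (A.give k e) (v + Pi.single k 1) := by
  have hek := notMem_of_marginal_eq_one hke
  have hjk : j ≠ k := by rintro rfl; exact hek he
  refine ⟨hjk, ?_⟩
  have hcard := card_sdiff_add_card_eq_card (singleton_subset_iff.2 he)
  rw [card_singleton, (hA j).2] at hcard
  -- first take `e` away from `j`, then `e` is an unallocated item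
  let A' := A.shrink (fun l => A.bundle l \ {e}) fun l => sdiff_subset
  have hout : ∀ l, l ≠ j → A.bundle l \ {e} = A.bundle l := fun l hl =>
    sdiff_eq_self_of_disjoint
      (disjoint_singleton_right.2 (disjoint_right.1 (A.disjoint l j hl) he))
  have hA' : Realizes f A' fun l => #(A'.bundle l) :=
    hA.mono hf (fun l => sdiff_subset) fun l => rfl
  refine ⟨fun l => #(A'.bundle l), ?_, ?_⟩
  · funext l
    by_cases hl : l = j
    · subst hl
      simp [A', Allocation.shrink, ← hcard]
    · simp [A', Allocation.shrink, hl, hout l hl, (hA l).2]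
  · have hgive : A.give k e = A'.give k e := by
      ext l a
      by_cases hl : l = k
      · subst hl
        simp only [Allocation.give, A', Allocation.shrink, if_true, mem_insert, mem_sdiff,
          mem_singleton]
        tauto
      · simp [Allocation.give, A', Allocation.shrink, hl]
    rw [hgive]
    refine hA'.give_of_unallocated ?_ fun l => by simp [A', Allocation.shrink]
    change f k (A.bundle k \ {e} ∪ {e}) = f k (A.bundle k \ {e}) + 1
    rwa [hout k hjk.symm]

/-- If agent `i` envies agent `j`, then one unit of utility can be transferred from `j` to `i`. -/
lemma Realizes.exists_transfer (hf : ∀ i, IsSubmodularDichotomous (f i)) {A : Allocation n M}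
    {x : Fin n → ℕ} (hA : Realizes f A x) {i j : Fin n}
    (hij : f i (A.bundle i) < f i (A.bundle j)) :
    i ≠ j ∧ ∃ v : Fin n → ℕ, x = v + Pi.single j 1 ∧ Feasible f (v + Pi.single i 1) := by
  obtain ⟨e, he, hie⟩ := (hf i).exists_augment hij
  obtain ⟨hji, v, hv, hgive⟩ := hA.give_of_mem hf hie he
  exact ⟨hji.symm, v, hv, _, hgive⟩

lemma exists_exchange_aux (hf : ∀ i, IsSubmodularDichotomous (f i)) {B : Allocation n M}
    {y : Fin n → ℕ} (hB : Realizes f B y) (N : ℕ) :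
    ∀ (A : Allocation n M) (v : Fin n → ℕ) (k : Fin n), Realizes f A v → v k < y k →
      ∑ l, #(B.bundle l \ A.bundle l) < N →
      Feasible f (v + Pi.single k 1) ∨
        ∃ (w : Fin n → ℕ) (j : Fin n), v + Pi.single k 1 = w + Pi.single j 1 ∧ y j ≤ w j ∧
          Feasible f w := by
  induction N with
  | zero => intro A v k _ _ h; omega
  | succ N ih =>
    intro A v k hA hk hN
    have hlt : f k (A.bundle k) < f k (B.bundle k) := by
      rw [(hA k).1, (hB k).1]; exact_mod_cast hk
    obtain ⟨e, heB, hke⟩ := (hf k).exists_augment hlt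
    by_cases he : ∀ j, e ∉ A.bundle j
    · exact Or.inl ⟨_, hA.give_of_unallocated hke he⟩
    · push Not at he
      obtain ⟨j, he⟩ := he
      obtain ⟨hjk, u, rfl, hgive⟩ := hA.give_of_mem hf hke he
      have hswap : u + Pi.single j 1 + Pi.single k 1 = u + Pi.single k 1 + Pi.single j 1 :=
        add_right_comm _ _ _
      rcases le_or_gt (y j) ((u + Pi.single k 1 : Fin n → ℕ) j) with hj | hj
      · exact Or.inr ⟨_, j, hswap, hj, _, hgive⟩
      · rw [hswap]
        refine ih _ _ j hgive hj (lt_of_lt_of_le ?_ (Nat.lt_succ_iff.1 hN))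
        -- the item `e` has moved to its owner in `B`
        have hsub : ∀ l, B.bundle l \ (A.give k e).bundle l ⊆ B.bundle l \ A.bundle l := by
          intro l a ha
          by_cases hl : l = k
          · subst hl
            simp only [Allocation.give, if_true, mem_sdiff, mem_insert, not_or] at ha
            exact mem_sdiff.2 ⟨ha.1, ha.2.2⟩
          · simp only [Allocation.give, hl, if_false, mem_sdiff, mem_singleton, not_and,
              not_not] at ha
            refine mem_sdiff.2 ⟨ha.1, fun haA => ?_⟩
            rw [ha.2 haA] at ha
            exact disjoint_left.1 (B.disjoint l k hl) ha.1 heB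
        refine sum_lt_sum (fun l _ => card_le_card (hsub l)) ⟨k, mem_univ k, card_lt_card ?_⟩
        refine (ssubset_iff_of_subset (hsub k)).2
          ⟨e, mem_sdiff.2 ⟨heB, notMem_of_marginal_eq_one hke⟩, ?_⟩
        simp [Allocation.give]

/-- The exchange property of polymatroids. An item that `i` owns in `B` is moved to `i` in `A`; if
this leaves its former owner `k` with no more than in `B`, then `k` gets an item that she owns in
`B`, and so on. The process stops since the overlap with `B` increases. -/
lemma exists_exchange (hf : ∀ i, IsSubmodularDichotomous (f i)) {x y : Fin n → ℕ}
    (hx : Feasible f x) (hy : Feasible f y) {i : Fin n} (hi : x i < y i) :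
    Feasible f (x + Pi.single i 1) ∨
      ∃ (v : Fin n → ℕ) (j : Fin n), x = v + Pi.single j 1 ∧ y j ≤ v j ∧ j ≠ i ∧
        Feasible f (v + Pi.single i 1) := by
  obtain ⟨A, hA⟩ := hx
  obtain ⟨B, hB⟩ := hy
  refine (exists_exchange_aux hf hB _ A x i hA hi (Nat.lt_succ_self _)).imp_right ?_
  rintro ⟨w, j, hw, hj, hfw⟩
  have hpt : ∀ l, x l + (Pi.single i 1 : Fin n → ℕ) l = w l + (Pi.single j 1 : Fin n → ℕ) l :=
    fun l => congrFun hw l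
  have hji : j ≠ i := by
    rintro rfl
    have := hpt j
    omega
  have hwi := hpt i
  simp only [Pi.single_eq_same, Pi.single_eq_of_ne hji.symm] at hwi
  have hu : w = (w - Pi.single i 1) + Pi.single i 1 := by
    refine (tsub_add_cancel_of_le fun l => ?_).symm
    by_cases hl : l = i
    · subst hl; simp; omega
    · simp [hl]
  refine ⟨w - Pi.single i 1, j, ?_, ?_, hji, by rwa [← hu]⟩
  · rw [hu, add_right_comm] at hw
    exact add_right_cancel hw
  · simpa [hji] using hj

end Feasible

/-! ### Vectors without improving transfers -/

lemma sum_apply_add_single {n : ℕ} (φ : Fin n → ℕ → ℝ) (v : Fin n → ℕ) (i : Fin n) :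
    ∑ k, φ k ((v + Pi.single i 1 : Fin n → ℕ) k) =
      ∑ k, φ k (v k) + (φ i (v i + 1) - φ i (v i)) := by
  rw [← add_sum_erase _ _ (mem_univ i), ← add_sum_erase univ (fun k => φ k (v k)) (mem_univ i)]
  have : ∑ k ∈ univ.erase i, φ k ((v + Pi.single i 1 : Fin n → ℕ) k) =
      ∑ k ∈ univ.erase i, φ k (v k) :=
    sum_congr rfl fun k hk => by simp [ne_of_mem_erase hk]
  rw [this]
  simp only [Pi.add_apply, Pi.single_eq_same]
  ring

section Optimal

variable {M : Type*} {n : ℕ}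

/-- A feasible vector `x` is optimal for the offsets `ε` if no coordinate can be increased, and if
no unit that can be transferred from `i` to `j` makes the vector `x + ε` more equal: before either
of them gets that unit, `i` is not ahead of `j`. -/
structure IsOptimal (f : Fin n → Finset M → ℝ) (ε : Fin n → ℝ) (x : Fin n → ℕ) : Prop where
  feasible : Feasible f x
  maximal : ∀ i, ¬ Feasible f (x + Pi.single i 1)
  transfer : ∀ (v : Fin n → ℕ) (i j : Fin n), x = v + Pi.single i 1 →
    Feasible f (v + Pi.single j 1) → v i + ε i ≤ v j + ε j

/-- A function of utility vectors that does not decrease if an agent gets one more unit, nor if a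
unit goes to the poorer one of two agents instead of the richer one, as measured with the
offsets `ε`. -/
structure IsEgalitarian (ε : Fin n → ℝ) (Ψ : (Fin n → ℕ) → ℝ) : Prop where
  mono : ∀ (v : Fin n → ℕ) (i : Fin n), Ψ v ≤ Ψ (v + Pi.single i 1)
  transfer : ∀ (v : Fin n → ℕ) (i j : Fin n), v i + ε i ≤ v j + ε j →
    Ψ (v + Pi.single j 1) ≤ Ψ (v + Pi.single i 1)

variable {f : Fin n → Finset M → ℝ} {ε : Fin n → ℝ} {x y : Fin n → ℕ}

lemma IsEgalitarian.of_sum {φ : Fin n → ℕ → ℝ} (hmono : ∀ i a, φ i a ≤ φ i (a + 1))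
    (hdiff : ∀ i j (a b : ℕ), a + ε i ≤ b + ε j → φ j (b + 1) - φ j b ≤ φ i (a + 1) - φ i a) :
    IsEgalitarian ε fun v => ∑ k, φ k (v k) := by
  refine ⟨fun v i => ?_, fun v i j h => ?_⟩ <;> simp only [sum_apply_add_single]
  · linarith [hmono i (v i)]
  · linarith [hdiff i j _ _ h]

lemma exists_isOptimal [DecidableEq M] [Fintype M] (hf : ∀ i, IsSubmodularDichotomous (f i))
    (ε : Fin n → ℝ) (hε : ∀ i, 0 ≤ ε i ∧ ε i ≤ 1) : ∃ x, IsOptimal f ε x := by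
  -- maximize the total first (the constant below makes every unit worth more than the change of the
  -- square), then minimize the sum of squares
  let φ : Fin n → ℕ → ℝ := fun k t => (2 * Fintype.card M + 4) * t - (t + ε k) ^ 2
  obtain ⟨x, hx, hmax⟩ := Set.exists_max_image {x | Feasible f x} (fun x => ∑ k, φ k (x k))
    finite_setOf_feasible ⟨0, feasible_zero hf⟩
  refine ⟨x, hx, fun i hi => ?_, fun v i j hv hj => ?_⟩
  · have h := hmax _ hi
    simp only [sum_apply_add_single] at h
    have hcard : (x i : ℝ) ≤ Fintype.card M := by
      obtain ⟨A, hA⟩ := hx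
      exact_mod_cast (hA i).2.ge.trans (card_le_univ _)
    simp only [φ] at h
    push_cast at h
    nlinarith [(hε i).2]
  · have h := hmax _ hj
    subst hv
    simp only [sum_apply_add_single] at h
    simp only [φ] at h
    push_cast at h
    nlinarith

/-- Starting from any feasible `y`, an optimal vector `x` is reached by moves that do not decrease
an egalitarian function. Each move increases a coordinate `i` with `y i < x i` for which `x i + ε i`
is smallest, possibly at the expense of a coordinate `j` with `x j < y j`. For every such `j`,
optimality of `x`, applied to an exchange of `x` towards `y`, bounds `x i + ε i` by `x j + ε j + 1`.
-/
lemma IsOptimal.apply_le [DecidableEq M] (hf : ∀ i, IsSubmodularDichotomous (f i))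
    (hx : IsOptimal f ε x) {Ψ : (Fin n → ℕ) → ℝ} (hΨ : IsEgalitarian ε Ψ) (hy : Feasible f y) :
    Ψ y ≤ Ψ x := by
  induction hN : ∑ k, (x k - y k) generalizing y with
  | zero =>
    have hxy : ∀ k, x k ≤ y k := by simpa [Nat.sub_eq_zero_iff_le] using hN
    suffices x = y by rw [this]
    refine funext fun k => (hxy k).antisymm ?_
    by_contra! hk
    rcases exists_exchange hf hx.feasible hy hk with h | ⟨v, j, rfl, hj, -, -⟩
    · exact hx.maximal k h
    · have := hxy j
      simp at this
      omega
  | succ N ih =>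
    have hne : (univ.filter fun k => y k < x k).Nonempty := by
      by_contra! h
      rw [filter_eq_empty_iff] at h
      rw [sum_eq_zero fun k hk => Nat.sub_eq_zero_of_le (not_lt.1 (h hk))] at hN
      omega
    obtain ⟨i, hi, hmin⟩ := exists_min_image _ (fun k => x k + ε k) hne
    simp only [mem_filter, mem_univ, true_and] at hi hmin
    have hdist : ∀ z : Fin n → ℕ, z i = y i + 1 → (∀ k, k ≠ i → x k - z k = x k - y k) →
        ∑ k, (x k - z k) = N := by
      intro z hzi hz
      rw [← add_sum_erase _ _ (mem_univ i)] at hN ⊢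
      rw [sum_congr rfl fun k hk => hz k (ne_of_mem_erase hk)]
      omega
    rcases exists_exchange hf hy hx.feasible hi with h | ⟨v, j, rfl, hj, hji, h⟩
    · refine (hΨ.mono y i).trans (ih h (hdist _ (by simp) fun k hk => by simp [hk]))
    · have hle : v i + ε i ≤ v j + ε j := by
        have hjx : x j < (v + Pi.single j 1 : Fin n → ℕ) j := by simp; omega
        rcases exists_exchange hf hx.feasible hy hjx with h' | ⟨w, l, rfl, hl, hlj, h'⟩
        · exact absurd h' (hx.maximal j)
        · have h₁ := hx.transfer w l j rfl h'
          have h₂ := hmin l (by simp; omega)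
          simp [hji.symm] at hi
          simp only [Pi.add_apply, Pi.single_eq_same, Pi.single_eq_of_ne hlj.symm, add_zero]
            at h₂ hj hi
          have h₃ : (v i : ℝ) + 1 ≤ ((w i + (Pi.single l 1 : Fin n → ℕ) i : ℕ) : ℝ) := by
            exact_mod_cast hi
          have h₄ : (w j : ℝ) ≤ v j := by exact_mod_cast hj
          push_cast at h₂
          push_cast at h₃
          linarith
      refine (hΨ.transfer v i j hle).trans (ih h (hdist _ (by simp [hji.symm]) fun k hk => ?_))
      by_cases hkj : k = j
      · subst hkj
        simp [hk]; omega
      · simp [hk, hkj]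

lemma isEgalitarian_hinge (ε : Fin n → ℝ) (c : ℝ) :
    IsEgalitarian ε fun v => ∑ k, -max (c - (v k + ε k)) 0 := by
  refine IsEgalitarian.of_sum (φ := fun k a => -max (c - (a + ε k)) 0) (fun i a => ?_)
    fun i j a b h => ?_
  · push_cast
    exact neg_le_neg (max_le_max (by linarith) le_rfl)
  · push_cast
    rcases max_cases (c - (a + ε i)) 0 with h₁ | h₁ <;>
    rcases max_cases (c - (b + ε j)) 0 with h₂ | h₂ <;>
    rcases max_cases (c - (a + 1 + ε i)) 0 with h₃ | h₃ <;>
    rcases max_cases (c - (b + 1 + ε j)) 0 with h₄ | h₄ <;>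
    rw [h₁.1, h₂.1, h₃.1, h₄.1] <;> linarith

lemma isEgalitarian_sum (ε : Fin n → ℝ) : IsEgalitarian ε fun v => ∑ k, (v k : ℝ) :=
  IsEgalitarian.of_sum (φ := fun _ a => (a : ℝ)) (fun i a => by simp)
    fun i j a b _ => by simp

lemma isEgalitarian_prod : IsEgalitarian (0 : Fin n → ℝ) fun v => ∏ k, (v k : ℝ) := by
  have key : ∀ (v : Fin n → ℕ) (i : Fin n), ∏ k, ((v + Pi.single i 1 : Fin n → ℕ) k : ℝ) =
      ∏ k, (v k : ℝ) + ∏ k ∈ univ.erase i, (v k : ℝ) := by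
    intro v i
    rw [← mul_prod_erase _ _ (mem_univ i),
      ← mul_prod_erase univ (fun k => (v k : ℝ)) (mem_univ i),
      prod_congr rfl (g := fun k => (v k : ℝ)) fun k hk => by simp [ne_of_mem_erase hk]]
    simp
    ring
  refine ⟨fun v i => ?_, fun v i j h => ?_⟩
  · rw [key]
    have : 0 ≤ ∏ k ∈ univ.erase i, (v k : ℝ) := prod_nonneg fun k _ => by positivity
    linarith
  · rw [key, key]
    by_cases hij : i = j
    · rw [hij]
    · rw [← mul_prod_erase _ _ (mem_erase.2 ⟨hij, mem_univ i⟩),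
        ← mul_prod_erase _ _ (mem_erase.2 ⟨Ne.symm hij, mem_univ j⟩), erase_right_comm]
      have : 0 ≤ ∏ k ∈ (univ.erase i).erase j, (v k : ℝ) := prod_nonneg fun k _ => by positivity
      have h' : (v i : ℝ) ≤ v j := by simpa using h
      nlinarith

/-- If offsets differ by less than `1`, then dropping them keeps optimality. -/
lemma IsOptimal.drop_offsets (hx : IsOptimal f ε x) (hε : ∀ i j, ε i < ε j + 1) :
    IsOptimal f 0 x := by
  refine ⟨hx.feasible, hx.maximal, fun v i j hv hj => ?_⟩
  have h := hx.transfer v i j hv hj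
  have : (v i : ℝ) < v j + 1 := by linarith [hε j i]
  have : v i ≤ v j := Nat.lt_succ_iff.1 (by exact_mod_cast this)
  simpa using this

end Optimal

/-! ### Numbers of low slots -/

section Caps

variable {M : Type*} {n : ℕ} {f : Fin n → Finset M → ℝ} {ε : Fin n → ℝ} {x y κ : Fin n → ℕ}

/-- Think of the `a`-th unit of utility of agent `k` as a slot at level `a + ε k`. Then `κ` is a
threshold if the slots `a < κ k` of all agents `k` form an initial segment of all slots, ordered by
level. -/
def IsThreshold (ε : Fin n → ℝ) (κ : Fin n → ℕ) : Prop :=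
  ∀ (k l : Fin n) (a b : ℕ), a + ε k ≤ b + ε l → b < κ l → a < κ k

/-- The number of slots of agent `k` below the level `c`. -/
noncomputable def slotsBelow (ε : Fin n → ℝ) (c : ℝ) (k : Fin n) : ℕ := ⌈c - ε k⌉₊

lemma lt_slotsBelow {c : ℝ} {k : Fin n} {a : ℕ} : a < slotsBelow ε c k ↔ a + ε k < c := by
  rw [slotsBelow, Nat.lt_ceil, lt_sub_iff_add_lt]

lemma slotsBelow_self (m : ℕ) (i : Fin n) : slotsBelow ε (m + ε i) i = m := by
  simp [slotsBelow]

lemma isThreshold_slotsBelow (c : ℝ) : IsThreshold ε (slotsBelow ε c) := by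
  intro k l a b h hb
  rw [lt_slotsBelow] at hb ⊢
  linarith

/-- If no two agents have slots at the same level, the slot that follows an initial segment of
slots can be appended to it. -/
lemma isThreshold_slotsBelow_add_single (hε : ∀ k l (a b : ℕ), a + ε k = b + ε l → k = l) (m : ℕ)
    (i : Fin n) : IsThreshold ε (slotsBelow ε (m + ε i) + Pi.single i 1) := by
  have key : ∀ k (a : ℕ), a < (slotsBelow ε (m + ε i) + Pi.single i 1 : Fin n → ℕ) k ↔
      a + ε k ≤ m + ε i := by
    intro k a
    by_cases hk : k = i
    · subst hk
      simp [slotsBelow_self]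
    · simp only [Pi.add_apply, Pi.single_eq_of_ne hk, add_zero, lt_slotsBelow]
      exact ⟨le_of_lt, fun h => h.lt_of_ne fun h' => hk (hε _ _ _ _ h')⟩
  intro k l a b h hb
  rw [key] at hb ⊢
  linarith

lemma IsThreshold.isEgalitarian (hκ : IsThreshold ε κ) :
    IsEgalitarian ε fun v => ((∑ k, min (v k) (κ k) : ℕ) : ℝ) := by
  have key : ∀ (b k : ℕ), ((min (b + 1) k : ℕ) : ℝ) - (min b k : ℕ) = if b < k then 1 else 0 := by
    intro b k
    split_ifs with h
    · rw [min_eq_left h.le, min_eq_left h]; simp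
    · rw [min_eq_right (by omega), min_eq_right (by omega)]; simp
  simp only [Nat.cast_sum]
  refine IsEgalitarian.of_sum (φ := fun k a => ((min a (κ k) : ℕ) : ℝ)) (fun i a => ?_)
    fun i j a b h => ?_
  · exact_mod_cast min_le_min_right _ (Nat.le_succ a)
  · rw [key, key]
    split_ifs with h₁ h₂ <;> try norm_num
    exact h₂ (hκ _ _ _ _ h h₁)

/-- An optimal vector fills as many slots of every initial segment as possible. -/
lemma IsOptimal.sum_min_le [DecidableEq M] (hf : ∀ i, IsSubmodularDichotomous (f i))
    (hx : IsOptimal f ε x) (hκ : IsThreshold ε κ) (hy : Feasible f y) :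
    ∑ k, min (y k) (κ k) ≤ ∑ k, min (x k) (κ k) := by
  have := hx.apply_le hf hκ.isEgalitarian hy
  exact_mod_cast this

end Caps

/-! ### Lorenz domination -/

section Lorenz

variable {n : ℕ} {u w : Fin n → ℝ}

lemma sum_hinge_sortedVector (u : Fin n → ℝ) (c : ℝ) :
    ∑ j, max (c - sortedVector u j) 0 = ∑ j, max (c - u j) 0 :=
  Equiv.sum_comp (Tuple.sort u) fun j => max (c - u j) 0

lemma monotone_sortedVector (u : Fin n → ℝ) : Monotone (sortedVector u) := Tuple.monotone_sort u

lemma lorenzGE_iff_forall_hinge :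
    LorenzGE u w ↔ ∀ c, ∑ i, max (c - u i) 0 ≤ ∑ i, max (c - w i) 0 := by
  simp only [← sum_hinge_sortedVector u, ← sum_hinge_sortedVector w]
  have hpart : ∀ (z : Fin n → ℝ) (c : ℝ) (k : Fin n),
      ∑ j ∈ Iic k, max (c - z j) 0 ≤ ∑ j, max (c - z j) 0 := fun z c k =>
    sum_le_sum_of_subset_of_nonneg (subset_univ _) fun _ _ _ => le_max_right _ _
  have hle : ∀ (z : Fin n → ℝ) (c : ℝ) (k : Fin n),
      ∑ j ∈ Iic k, (c - z j) ≤ ∑ j ∈ Iic k, max (c - z j) 0 := fun z c k =>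
    sum_le_sum fun _ _ => le_max_left _ _
  -- both sides are equal if `c` separates the `k` smallest entries from the others
  have heq : ∀ (z : Fin n → ℝ) (c : ℝ) (k : Fin n), (∀ j ≤ k, z j ≤ c) → (∀ j, k < j → c ≤ z j) →
      ∑ j, max (c - z j) 0 = ∑ j ∈ Iic k, (c - z j) := by
    intro z c k h₁ h₂
    rw [← sum_subset (subset_univ (Iic k)) fun j _ hj =>
      max_eq_right (sub_nonpos.2 (h₂ j (by simpa using hj)))]
    exact sum_congr rfl fun j hj => max_eq_left (sub_nonneg.2 (h₁ j (mem_Iic.1 hj)))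
  constructor
  · intro h c
    by_cases hne : (univ.filter fun j => sortedVector u j ≤ c).Nonempty
    · obtain ⟨k, hk, hmax⟩ := exists_max_image _ id hne
      simp only [mem_filter, mem_univ, true_and, id] at hk hmax
      rw [heq _ c k (fun j hj => (monotone_sortedVector u hj).trans hk)
        fun j hj => le_of_lt (not_le.1 fun hjc => (hmax j hjc).not_gt hj)]
      refine le_trans ?_ ((hle _ c k).trans (hpart _ c k))
      rw [sum_sub_distrib, sum_sub_distrib]
      linarith [h k]
    · rw [not_nonempty_iff_eq_empty, filter_eq_empty_iff] at hne
      rw [sum_eq_zero fun j hj => max_eq_right (sub_nonpos.2 (le_of_lt (not_le.1 (hne hj))))]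
      exact sum_nonneg fun _ _ => le_max_right _ _
  · intro h k
    have h₁ := h (sortedVector w k)
    rw [heq (sortedVector w) _ k (fun j hj => monotone_sortedVector w hj)
      fun j hj => monotone_sortedVector w hj.le] at h₁
    have h₂ := (hle _ (sortedVector w k) k).trans ((hpart (sortedVector u) _ k).trans h₁)
    rw [sum_sub_distrib, sum_sub_distrib] at h₂
    linarith

end Lorenz

section Optimal

variable {M : Type*} [DecidableEq M] {n : ℕ} {f : Fin n → Finset M → ℝ} {ε : Fin n → ℝ}
  {x : Fin n → ℕ}

lemma IsOptimal.hinge_le (hf : ∀ i, IsSubmodularDichotomous (f i)) (hx : IsOptimal f ε x)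
    {y : Fin n → ℕ} (hy : Feasible f y) (c : ℝ) :
    ∑ k, max (c - (x k + ε k)) 0 ≤ ∑ k, max (c - (y k + ε k)) 0 := by
  have := hx.apply_le hf (isEgalitarian_hinge ε c) hy
  simpa only [sum_neg_distrib, neg_le_neg_iff] using this

omit [DecidableEq M] in
lemma isOptimal_of_hinge_le (hx : Feasible f x)
    (h : ∀ y, Feasible f y → ∀ c,
      ∑ k, max (c - (x k + ε k)) 0 ≤ ∑ k, max (c - (y k + ε k)) 0) : IsOptimal f ε x := by
  have hsum := fun c => sum_apply_add_single (n := n) fun k a => max (c - (a + ε k)) 0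
  refine ⟨hx, fun i hi => ?_, fun v i j hv hj => ?_⟩
  · have h' := h _ hi (x i + ε i + 1)
    rw [hsum] at h'
    push_cast at h'
    rw [max_eq_right (by linarith), max_eq_left (by linarith)] at h'
    linarith
  · subst hv
    by_contra! hlt
    -- at this level, the unit counts in full for `j` and not for `i`
    have h' := h _ hj (v j + ε j + 1)
    rw [hsum, hsum] at h'
    push_cast at h'
    rw [max_eq_right (a := v j + ε j + 1 - (v i + 1 + ε i)) (by linarith),
      max_eq_right (a := v j + ε j + 1 - (v j + 1 + ε j)) (by linarith),
      max_eq_left (a := v j + ε j + 1 - (v j + ε j)) (by linarith)] at h'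
    have : max (v j + ε j + 1 - (v i + ε i)) 0 < 1 := max_lt (by linarith) one_pos
    linarith

lemma IsOptimal.isLorenzDominating (hf : ∀ i, IsSubmodularDichotomous (f i))
    (hx : IsOptimal f 0 x) {A : Allocation n M} (hA : Realizes f A x) :
    IsLorenzDominating f A := by
  intro B
  obtain ⟨y, hy, hBy⟩ := exists_feasible_utility_eq hf B
  have hAx : ∀ i, utility f A i = x i := fun i => (hA i).1
  refine lorenzGE_iff_forall_hinge.2 fun c => ?_
  simpa [hAx, hBy] using hx.hinge_le hf hy c

lemma IsOptimal.isWelfareMaximizing (hf : ∀ i, IsSubmodularDichotomous (f i))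
    (hx : IsOptimal f ε x) {A : Allocation n M} (hA : Realizes f A x) :
    IsWelfareMaximizing f A := by
  intro B
  obtain ⟨y, hy, hBy⟩ := exists_feasible_utility_eq hf B
  have hAx : ∀ i, utility f A i = x i := fun i => (hA i).1
  simpa [hAx, hBy] using hx.apply_le hf (isEgalitarian_sum ε) hy

lemma IsOptimal.isNSWMaximizing (hf : ∀ i, IsSubmodularDichotomous (f i))
    (hx : IsOptimal f 0 x) {A : Allocation n M} (hA : Realizes f A x) :
    IsNSWMaximizing f A := by
  intro B
  obtain ⟨y, hy, hBy⟩ := exists_feasible_utility_eq hf B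
  have hAx : ∀ i, utility f A i = x i := fun i => (hA i).1
  simpa [hAx, hBy] using hx.apply_le hf isEgalitarian_prod hy

end Optimal

/-! ### Prioritized egalitarian allocations -/

section Priority

variable {M : Type*} [DecidableEq M] {n : ℕ} {f : Fin n → Finset M → ℝ}
  {σ : Equiv.Perm (Fin n)}

/-- The value of the auxiliary item of agent `i`. -/
noncomputable def priorityOffset (σ : Equiv.Perm (Fin n)) (i : Fin n) : ℝ :=
  (((σ i : ℕ) : ℝ) + 1) / (n : ℝ) ^ 2

lemma priorityOffset_pos (σ : Equiv.Perm (Fin n)) (i : Fin n) : 0 < priorityOffset σ i := by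
  have : (0 : ℝ) < n := by exact_mod_cast i.pos
  unfold priorityOffset
  positivity

lemma priorityOffset_le_one (σ : Equiv.Perm (Fin n)) (i : Fin n) : priorityOffset σ i ≤ 1 := by
  have h₀ : (1 : ℝ) ≤ n := by exact_mod_cast i.pos
  have h₁ : ((σ i : ℕ) : ℝ) + 1 ≤ n := by exact_mod_cast (σ i).isLt
  unfold priorityOffset
  rw [div_le_one (by positivity)]
  nlinarith

lemma priorityOffset_lt_add_one (σ τ : Equiv.Perm (Fin n)) (i j : Fin n) :
    priorityOffset σ i < priorityOffset τ j + 1 := by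
  linarith [priorityOffset_le_one σ i, priorityOffset_pos τ j]

lemma priorityOffset_lt_iff {i j : Fin n} :
    priorityOffset σ i < priorityOffset σ j ↔ σ i < σ j := by
  have : (0 : ℝ) < n := by exact_mod_cast i.pos
  unfold priorityOffset
  rw [div_lt_div_iff_of_pos_right (by positivity), add_lt_add_iff_right, Nat.cast_lt, Fin.lt_def]

lemma le_of_add_priorityOffset_le {τ : Equiv.Perm (Fin n)} {k l : Fin n} {a b : ℕ}
    (h : a + priorityOffset σ k ≤ b + priorityOffset τ l) : a ≤ b := by
  have : (a : ℝ) < b + 1 := by linarith [priorityOffset_lt_add_one τ σ l k]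
  exact Nat.lt_succ_iff.1 (by exact_mod_cast this)

lemma eq_of_add_priorityOffset_eq (k l : Fin n) (a b : ℕ)
    (h : a + priorityOffset σ k = b + priorityOffset σ l) : k = l := by
  obtain rfl : a = b :=
    (le_of_add_priorityOffset_le h.le).antisymm (le_of_add_priorityOffset_le h.ge)
  by_contra hkl
  rcases lt_or_gt_of_ne (σ.injective.ne hkl) with h' | h' <;>
    linarith [priorityOffset_lt_iff.2 h']

omit [DecidableEq M] in
lemma utility_augmented_le (A : Allocation n (M ⊕ Fin n)) (i : Fin n) :
    utility (augmented σ f) A i ≤ utility f A.removeAux i + priorityOffset σ i := by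
  have := (priorityOffset_pos σ i).le
  simp only [utility, augmented, Allocation.removeAux]
  split_ifs
  · rfl
  · linarith

/-- Give the auxiliary items to their agents. -/
def Allocation.withAux (A : Allocation n M) : Allocation n (M ⊕ Fin n) where
  bundle i := (A.bundle i).disjSum {i}
  disjoint i j hij := by
    rw [Finset.disjoint_left]
    rintro (a | k) hi hj
    · exact disjoint_left.1 (A.disjoint i j hij) (inl_mem_disjSum.1 hi) (inl_mem_disjSum.1 hj)
    · rw [inr_mem_disjSum, mem_singleton] at hi hj
      exact hij (hi.symm.trans hj)

omit [DecidableEq M] in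
lemma removeAux_withAux (A : Allocation n M) : A.withAux.removeAux = A := by
  ext i a
  simp [Allocation.removeAux, Allocation.withAux]

omit [DecidableEq M] in
lemma utility_augmented_withAux (A : Allocation n M) (i : Fin n) :
    utility (augmented σ f) A.withAux i = utility f A i + priorityOffset σ i := by
  simp [utility, augmented, Allocation.withAux, priorityOffset]

lemma IsOptimal.isPEAllocation (hf : ∀ i, IsSubmodularDichotomous (f i)) {x : Fin n → ℕ}
    (hx : IsOptimal f (priorityOffset σ) x) {A : Allocation n M} (hA : Realizes f A x) :
    IsPEAllocation σ f A := by
  refine ⟨hA.isNonRedundant hf, A.withAux, fun B => ?_, removeAux_withAux A⟩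
  refine lorenzGE_iff_forall_hinge.2 fun c => ?_
  obtain ⟨y, hy, hBy⟩ := exists_feasible_utility_eq hf B.removeAux
  have hAx : ∀ i, utility f A i = x i := fun i => (hA i).1
  simp only [utility_augmented_withAux, hAx]
  refine (hx.hinge_le hf hy c).trans (sum_le_sum fun i _ => max_le_max ?_ le_rfl)
  have := utility_augmented_le (σ := σ) (f := f) B i
  rw [hBy] at this
  linarith

/-- The utility vector of a prioritized egalitarian allocation is optimal for the priority
offsets. -/
lemma IsPEAllocation.isOptimal (hf : ∀ i, IsSubmodularDichotomous (f i)) {A : Allocation n M}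
    (hA : IsPEAllocation σ f A) :
    IsOptimal f (priorityOffset σ) fun i => #(A.bundle i) := by
  obtain ⟨hnr, A', hA', rfl⟩ := hA
  have hreal := hnr.realizes hf
  refine isOptimal_of_hinge_le ⟨_, hreal⟩ ?_
  rintro y ⟨B, hB⟩ c
  have h := lorenzGE_iff_forall_hinge.1 (hA' B.withAux) c
  have hBy : ∀ i, utility f B i = y i := fun i => (hB i).1
  simp only [utility_augmented_withAux, hBy] at h
  refine le_trans (sum_le_sum fun i _ => max_le_max ?_ le_rfl) h
  have h' := utility_augmented_le (σ := σ) (f := f) A' i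
  have hi : utility f A'.removeAux i = _ := (hreal i).1
  rw [hi] at h'
  linarith

lemma exists_isPEAllocation [Fintype M] (hf : ∀ i, IsSubmodularDichotomous (f i))
    (σ : Equiv.Perm (Fin n)) : ∃ A, IsPEAllocation σ f A := by
  obtain ⟨x, hx⟩ := exists_isOptimal hf (priorityOffset σ) fun i =>
    ⟨(priorityOffset_pos σ i).le, priorityOffset_le_one σ i⟩
  obtain ⟨A, hA⟩ := hx.feasible
  exact ⟨A, hx.isPEAllocation hf hA⟩

end Priority

/-! ### Truthfulness -/

section Truthful

variable {M : Type*} [DecidableEq M] {n : ℕ}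

lemma sum_erase_add_single (v : Fin n → ℕ) (i k : Fin n) :
    ∑ l ∈ univ.erase i, (v + Pi.single k 1 : Fin n → ℕ) l =
      ∑ l ∈ univ.erase i, v l + if k = i then 0 else 1 := by
  simp only [Pi.add_apply, sum_add_distrib, sum_pi_single', mem_erase, mem_univ, and_true]
  split_ifs <;> simp_all

/-- If the agents other than `i` have less in total in `v` than in `w`, their total can be increased
by one unit, at the cost of at most one unit of agent `i`. -/
lemma exists_feasible_sum_erase {f : Fin n → Finset M → ℝ}
    (hf : ∀ i, IsSubmodularDichotomous (f i)) (i : Fin n) {v w : Fin n → ℕ} (hv : Feasible f v)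
    (hw : Feasible f w) (hlt : ∑ k ∈ univ.erase i, v k < ∑ k ∈ univ.erase i, w k) :
    ∃ z, Feasible f z ∧ v i ≤ z i + 1 ∧
      ∑ k ∈ univ.erase i, z k = ∑ k ∈ univ.erase i, v k + 1 ∧
      ∀ k, k ≠ i → z k ≤ max (v k) (w k) := by
  induction hN : ∑ k ∈ univ.erase i, (w k - v k) using Nat.strong_induction_on generalizing v with
  | _ N ih =>
    obtain ⟨k, hk, hkvw⟩ := exists_lt_of_sum_lt hlt
    have hki := ne_of_mem_erase hk
    rcases exists_exchange hf hv hw hkvw with h | ⟨u, j, rfl, hj, hjk, h⟩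
    · refine ⟨_, h, by simp [hki.symm], by rw [sum_erase_add_single, if_neg hki], fun l _ => ?_⟩
      by_cases hl : l = k
      · subst hl
        rw [Pi.add_apply, Pi.single_eq_same]
        exact le_max_of_le_right hkvw
      · simp [hl]
    · simp only [Pi.add_apply, Pi.single_eq_of_ne hjk.symm, add_zero] at hkvw
      have hbound : ∀ l, (u + Pi.single k 1 : Fin n → ℕ) l ≤
          max ((u + Pi.single j 1 : Fin n → ℕ) l) (w l) := by
        intro l
        by_cases hl : l = k
        · subst hl
          rw [Pi.add_apply, Pi.single_eq_same]
          exact le_max_of_le_right hkvw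
        · simp [hl]
      by_cases hji : j = i
      · subst hji
        refine ⟨_, h, by simp [hki.symm], ?_, fun l _ => hbound l⟩
        rw [sum_erase_add_single, sum_erase_add_single, if_neg hki, if_pos rfl]
      · have hsum : ∑ l ∈ univ.erase i, (u + Pi.single k 1 : Fin n → ℕ) l =
            ∑ l ∈ univ.erase i, (u + Pi.single j 1 : Fin n → ℕ) l := by
          rw [sum_erase_add_single, sum_erase_add_single, if_neg hki, if_neg hji]
        have hdist : ∑ l ∈ univ.erase i, (w l - (u + Pi.single k 1 : Fin n → ℕ) l) < N := by
          rw [← hN]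
          refine sum_lt_sum (fun l _ => ?_) ⟨k, hk, ?_⟩
          · by_cases hl : l = j
            · subst hl
              simp [hjk]; omega
            · simp [hl]; omega
          · simp [hjk.symm]; omega
        obtain ⟨z, hz, hzi, hzsum, hzmax⟩ := ih _ hdist h (hsum ▸ hlt) rfl
        refine ⟨z, hz, ?_, hzsum.trans (by rw [hsum]), fun l hl =>
          (hzmax l hl).trans (max_le (hbound l) (le_max_right _ _))⟩
        simpa [hki.symm, Ne.symm hji] using hzi

variable {f g : Fin n → Finset M → ℝ} {i : Fin n} {S : Finset M}

/-- If agent `i` only values the items of a set `S` that is independent for her, then there are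
fewer feasible vectors. -/
lemma Feasible.of_update (hg : ∀ k, IsSubmodularDichotomous (g k)) (hfg : ∀ k, k ≠ i → f k = g k)
    (hS : g i S = #S) {x : Fin n → ℕ}
    (hx : Feasible (Function.update f i fun T => (#(T ∩ S) : ℝ)) x) : Feasible g x := by
  obtain ⟨A, hA⟩ := hx
  refine ⟨A, fun k => ?_⟩
  have hk := hA k
  by_cases hki : k = i
  · subst hki
    simp only [Function.update_self] at hk
    have hcard : #(A.bundle k ∩ S) = #(A.bundle k) := by
      rw [hk.2]; exact_mod_cast hk.1
    have hsub : A.bundle k ⊆ S :=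
      inter_eq_left.1 (eq_of_subset_of_card_le inter_subset_left hcard.ge)
    exact ⟨by rw [(hg k).independent_subset hsub hS, hk.2], hk.2⟩
  · rw [Function.update_of_ne hki, hfg k hki] at hk
    exact hk

lemma Realizes.feasible_update {A : Allocation n M} {x : Fin n → ℕ} (hA : Realizes g A x)
    (hfg : ∀ k, k ≠ i → f k = g k) {T : Finset M} (hTA : T ⊆ A.bundle i) (hTS : T ⊆ S) :
    Feasible (Function.update f i fun T => (#(T ∩ S) : ℝ)) (Function.update x i #T) := by
  refine ⟨A.shrink (Function.update A.bundle i T) fun k => ?_, fun k => ?_⟩ <;>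
    by_cases hki : k = i
  · subst hki; simpa using hTA
  · simp [hki]
  · subst hki; simp [Allocation.shrink, inter_eq_left.2 hTS]
  · simpa [Allocation.shrink, hki, hfg k hki] using hA k

/-- A report that differs from the valuation `g i` does not pay for agent `i`. Here `x` and `y` are
the outcomes at the true and at the false valuation. If the bundle `B i` contained an independent
set `S` with more than `x i` items, take the first slot of `i` that is not filled in `x`. It is
filled in `y`, so filling it is compatible with the slots of the other agents that are filled in `y`
below it; since `x` is optimal, the other agents fill more of these in `x`. An exchange in the
instance in which `i` only values `S`, which is feasible for both valuations of `i`, contradicts the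
optimality of `y`. -/
lemma IsOptimal.apply_bundle_le (hf : ∀ k, IsSubmodularDichotomous (f k))
    (hg : ∀ k, IsSubmodularDichotomous (g k)) (hfg : ∀ k, k ≠ i → f k = g k) {ε : Fin n → ℝ}
    (hε : ∀ k l (a b : ℕ), a + ε k = b + ε l → k = l) {x y : Fin n → ℕ} (hx : IsOptimal g ε x)
    (hy : IsOptimal f ε y) {B : Allocation n M} (hB : Realizes f B y) :
    g i (B.bundle i) ≤ x i := by
  obtain ⟨S, hSB, hgS, hScard⟩ := (hg i).exists_independent_subset (B.bundle i)
  rw [← hgS, ← hScard, Nat.cast_le]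
  by_contra! hlt
  have hgS' : g i S = #S := hScard.symm
  have hfS : f i S = #S := (hf i).independent_subset hSB (by rw [(hB i).1, (hB i).2])
  have hφ : ∀ k, IsSubmodularDichotomous
      (Function.update f i (fun T => (#(T ∩ S) : ℝ)) k) := by
    intro k
    by_cases hk : k = i
    · subst hk
      rw [Function.update_self]
      exact isSubmodularDichotomous_card_inter S
    · rw [Function.update_of_ne hk]
      exact hf k
  set κ := slotsBelow ε (x i + ε i) with hκdef
  have hκi : κ i = x i := slotsBelow_self _ _
  have hκ : IsThreshold ε κ := isThreshold_slotsBelow _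
  have hκ' : IsThreshold ε (κ + Pi.single i 1) := isThreshold_slotsBelow_add_single hε _ _
  -- the slots of `x` and `y` below the level of the slot in question, without those of `i` in `x`,
  -- and with this slot in `y`
  let a : Fin n → ℕ := Function.update (fun k => min (x k) (κ k)) i 0
  let b : Fin n → ℕ := Function.update (fun k => min (y k) (κ k)) i (x i + 1)
  have ha : Feasible (Function.update f i fun T => (#(T ∩ S) : ℝ)) a := by
    obtain ⟨A, hA⟩ := hx.feasible
    refine (hA.feasible_update hfg (empty_subset _) (empty_subset S)).mono hφ fun k => ?_
    by_cases hk : k = i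
    · subst hk; simp [a]
    · simp [a, hk]
  have hb : Feasible (Function.update f i fun T => (#(T ∩ S) : ℝ)) b := by
    refine (hB.feasible_update (fun _ _ => rfl) hSB subset_rfl).mono hφ fun k => ?_
    by_cases hk : k = i
    · subst hk; simpa [b] using hlt
    · simp [b, hk]
  have haE : ∑ k ∈ univ.erase i, a k = ∑ k ∈ univ.erase i, min (x k) (κ k) :=
    sum_congr rfl fun k hk => by simp [a, ne_of_mem_erase hk]
  have hbE : ∑ k ∈ univ.erase i, b k = ∑ k ∈ univ.erase i, min (y k) (κ k) :=
    sum_congr rfl fun k hk => by simp [b, ne_of_mem_erase hk]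
  have hlt' : ∑ k ∈ univ.erase i, b k < ∑ k ∈ univ.erase i, a k := by
    have h := hx.sum_min_le hg hκ' (hb.of_update hg hfg hgS')
    rw [← add_sum_erase _ _ (mem_univ i), ← add_sum_erase univ (fun k => min (x k) _)
      (mem_univ i)] at h
    have h₁ : ∑ k ∈ univ.erase i, min (b k) ((κ + Pi.single i 1 : Fin n → ℕ) k) =
        ∑ k ∈ univ.erase i, b k :=
      sum_congr rfl fun k hk => by simp [b, ne_of_mem_erase hk]
    have h₂ : ∑ k ∈ univ.erase i, min (x k) ((κ + Pi.single i 1 : Fin n → ℕ) k) =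
        ∑ k ∈ univ.erase i, a k :=
      sum_congr rfl fun k hk => by simp [a, ne_of_mem_erase hk]
    have hbi : b i = x i + 1 := by simp [b]
    rw [h₁, h₂, hbi, Pi.add_apply, Pi.single_eq_same, hκi] at h
    omega
  obtain ⟨z, hz, hzi, hzsum, hzmax⟩ := exists_feasible_sum_erase hφ i hb ha hlt'
  have h := hy.sum_min_le hf hκ (hz.of_update hf (fun _ _ => rfl) hfS)
  rw [← add_sum_erase _ _ (mem_univ i), ← add_sum_erase univ (fun k => min (y k) _)
    (mem_univ i), ← hbE] at h
  have h₁ : ∑ k ∈ univ.erase i, min (z k) (κ k) = ∑ k ∈ univ.erase i, z k :=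
    sum_congr rfl fun k hk => min_eq_left <| by
      refine (hzmax k (ne_of_mem_erase hk)).trans (max_le ?_ ?_) <;>
        simp [a, b, ne_of_mem_erase hk]
  have hbi : b i = x i + 1 := by simp [b]
  rw [h₁, hzsum, hκi] at h
  omega

lemma IsPEMechanism.isTruthful {σ : Equiv.Perm (Fin n)} {mech : Mechanism n M}
    (h : IsPEMechanism σ mech) : mech.IsTruthful := by
  intro i g hg r
  have hleg : ∀ r : Fin n → Report M, ∀ k, IsSubmodularDichotomous (legalized (r k)) :=
    fun r k => isSubmodularDichotomous_legalized (r k)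
  have hi : legalized (Function.update r i (some g) i) = g := by
    rw [Function.update_self, legalized_some hg]
  have hx := (h (Function.update r i (some g))).isOptimal (hleg _)
  have hxreal := (h (Function.update r i (some g))).1.realizes (hleg _) i
  have hle := hx.apply_bundle_le (i := i) (hleg r) (hleg _)
    (fun k hk => by rw [Function.update_of_ne hk]) eq_of_add_priorityOffset_eq
    ((h r).isOptimal (hleg r)) ((h r).1.realizes (hleg r))
  rw [← hxreal.1] at hle
  simpa only [hi] using hle

end Truthful

/-! ### Envy under a random priority order -/

section Envy

variable {M : Type*} [DecidableEq M] {n : ℕ} {f : Fin n → Finset M → ℝ}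

lemma sum_min_add_single (x κ : Fin n → ℕ) (i : Fin n) :
    ∑ k, min (x k) ((κ + Pi.single i 1 : Fin n → ℕ) k) =
      ∑ k, min (x k) (κ k) + if κ i < x i then 1 else 0 := by
  rw [← add_sum_erase _ _ (mem_univ i),
    ← add_sum_erase univ (fun k => min (x k) (κ k)) (mem_univ i),
    sum_congr rfl (g := fun k => min (x k) (κ k)) fun k hk => by simp [ne_of_mem_erase hk],
    Pi.add_apply, Pi.single_eq_same]
  split_ifs <;> omega

lemma sum_add_single_min (x κ : Fin n → ℕ) (i : Fin n) :
    ∑ k, min ((x + Pi.single i 1 : Fin n → ℕ) k) (κ k) =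
      ∑ k, min (x k) (κ k) + if x i < κ i then 1 else 0 := by
  simp only [min_comm _ (κ _)]
  exact sum_min_add_single κ x i

lemma sum_add_single_min_add_single (x κ : Fin n → ℕ) (i : Fin n) :
    ∑ k, min ((x + Pi.single i 1 : Fin n → ℕ) k) ((κ + Pi.single i 1 : Fin n → ℕ) k) =
      ∑ k, min (x k) (κ k) + 1 := by
  rw [sum_add_single_min, sum_min_add_single, Pi.add_apply, Pi.single_eq_same]
  split_ifs <;> omega

lemma priorityOffset_mul_swap (σ : Equiv.Perm (Fin n)) (i j k : Fin n) :
    priorityOffset (σ * Equiv.swap i j) k = priorityOffset σ (Equiv.swap i j k) := rfl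

/-- Suppose that `j` gets the unit for which `i` and `j` compete when `j` precedes `i`. If `i` and
`j` change places in the priority order, then `i` gets at least this unit, and `j` does not get it.
In terms of slots, one compares how many slots can be filled up to the slot of `i` for this unit,
and how many up to the slot of `j`. -/
lemma IsOptimal.swap {σ : Equiv.Perm (Fin n)} {i j : Fin n} (hσ : σ i < σ j)
    (hf : ∀ k, IsSubmodularDichotomous (f k)) {x v : Fin n → ℕ}
    (hx : IsOptimal f (priorityOffset σ) x)
    (hv : IsOptimal f (priorityOffset (σ * Equiv.swap i j)) (v + Pi.single j 1))
    (hvi : Feasible f (v + Pi.single i 1)) (hij : v i = v j) : v i < x i ∧ x j ≤ v i := by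
  have hlt := priorityOffset_lt_iff.2 hσ
  have hlt' := priorityOffset_lt_add_one σ σ j i
  have hne : i ≠ j := by rintro rfl; exact hσ.false
  set m := v i
  have hinj := eq_of_add_priorityOffset_eq (σ := σ)
  have hinj' := eq_of_add_priorityOffset_eq (σ := σ * Equiv.swap i j)
  have hεi : priorityOffset (σ * Equiv.swap i j) i = priorityOffset σ j := by
    simp [priorityOffset_mul_swap]
  have hεj : priorityOffset (σ * Equiv.swap i j) j = priorityOffset σ i := by
    simp [priorityOffset_mul_swap]
  have hεk : ∀ k, k ≠ i → k ≠ j → priorityOffset (σ * Equiv.swap i j) k = priorityOffset σ k :=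
    fun k hki hkj => by simp [priorityOffset_mul_swap, Equiv.swap_apply_of_ne_of_ne hki hkj]
  have hceil₁ : ⌈m + priorityOffset σ i - priorityOffset σ j⌉₊ = m := by
    refine le_antisymm (Nat.ceil_le.2 (by linarith)) (Nat.le_of_lt_succ ?_)
    rw [← Nat.cast_lt (α := ℝ)]
    push_cast
    linarith [Nat.le_ceil (m + priorityOffset σ i - priorityOffset σ j)]
  have hceil₂ : ⌈m + priorityOffset σ j - priorityOffset σ i⌉₊ = m + 1 := by
    refine le_antisymm (Nat.ceil_le.2 (by push_cast; linarith)) (Nat.lt_ceil.2 (by linarith))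
  set κ₁ := slotsBelow (priorityOffset σ) (m + priorityOffset σ i) with hκ₁
  set κ₂ := slotsBelow (priorityOffset σ) (m + priorityOffset σ j) with hκ₂
  have hκ₁i : κ₁ i = m := slotsBelow_self _ _
  have hκ₁j : κ₁ j = m := hceil₁
  have hκ₂i : κ₂ i = m + 1 := hceil₂
  have hκ₂j : κ₂ j = m := slotsBelow_self _ _
  -- up to the exchanged slots of `i` and `j`, both priority orders order the slots alike
  have hth₁ : IsThreshold (priorityOffset (σ * Equiv.swap i j)) κ₁ := by
    have : κ₁ = slotsBelow (priorityOffset (σ * Equiv.swap i j)) (m + priorityOffset σ i) := by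
      funext k
      by_cases hki : k = i
      · rw [hki, hκ₁i, slotsBelow, hεi, hceil₁]
      by_cases hkj : k = j
      · rw [hkj, hκ₁j, slotsBelow, hεj]; simp
      rw [slotsBelow, hεk k hki hkj, hκ₁, slotsBelow]
    rw [this]
    exact isThreshold_slotsBelow _
  have hth₂ : IsThreshold (priorityOffset (σ * Equiv.swap i j)) (κ₂ + Pi.single j 1) := by
    have : κ₂ + Pi.single j 1 = slotsBelow (priorityOffset (σ * Equiv.swap i j))
        (m + priorityOffset (σ * Equiv.swap i j) i) + Pi.single i 1 := by
      funext k
      by_cases hki : k = i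
      · rw [hki]; simp [hκ₂i, slotsBelow_self, hne]
      by_cases hkj : k = j
      · rw [hkj]; simp [hκ₂j, slotsBelow, hεi, hεj, hceil₂, hne.symm]
      simp [hki, hkj, slotsBelow, hεk k hki hkj, hεi, hκ₂]
    rw [this]
    exact isThreshold_slotsBelow_add_single hinj' _ _
  have h₁ := hx.sum_min_le hf (isThreshold_slotsBelow_add_single hinj m i) hvi
  have h₂ := hv.sum_min_le hf hth₁ hx.feasible
  have h₃ := hv.sum_min_le hf hth₂ hx.feasible
  have h₄ := hx.sum_min_le hf (isThreshold_slotsBelow (m + priorityOffset σ j)) hvi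
  rw [← hκ₁, sum_add_single_min_add_single, sum_min_add_single, hκ₁i] at h₁
  rw [sum_add_single_min, hκ₁j, if_neg (by omega)] at h₂
  rw [sum_add_single_min_add_single, sum_min_add_single, hκ₂j] at h₃
  rw [← hκ₂, sum_add_single_min, hκ₂i, if_pos (Nat.lt_succ_self m)] at h₄
  constructor
  · by_contra h
    rw [if_neg h] at h₁
    omega
  · by_contra! h
    rw [if_pos h] at h₃
    omega

/-- The values for agent `i` of her own bundle in `A` and `A'` dominate those of the bundle of `j`
if `A` and `A'` belong to priority orders that differ by exchanging `i` and `j`. She does not envy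
`j` when she precedes `j`; when she follows and envies `j`, the envy is for one unit, and
`IsOptimal.swap` applies. -/
lemma IsPEAllocation.add_le_add_of_swap {σ : Equiv.Perm (Fin n)} {i j : Fin n} (hσ : σ i < σ j)
    (hf : ∀ k, IsSubmodularDichotomous (f k)) {A A' : Allocation n M} (hA : IsPEAllocation σ f A)
    (hA' : IsPEAllocation (σ * Equiv.swap i j) f A') {G : ℝ → ℝ} (hG : Monotone G) :
    G (f i (A.bundle j)) + G (f i (A'.bundle j)) ≤
      G (f i (A.bundle i)) + G (f i (A'.bundle i)) := by
  have hx := hA.isOptimal hf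
  have hx' := hA'.isOptimal hf
  have hreal := hA.1.realizes hf
  have hreal' := hA'.1.realizes hf
  have hle : f i (A.bundle j) ≤ f i (A.bundle i) := by
    by_contra! hlt
    obtain ⟨hij, v, hv, hvi⟩ := hreal.exists_transfer hf hlt
    have h₁ := hx.transfer v j i hv hvi
    have h₂ : v j < v i := by
      have := priorityOffset_lt_iff.2 hσ
      have : (v j : ℝ) < v i := by linarith
      exact_mod_cast this
    have h₃ := (hf i).le_card (A.bundle j)
    rw [(hreal i).1] at hlt
    have h₄ : #(A.bundle i) < #(A.bundle j) := by exact_mod_cast hlt.trans_le h₃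
    have h₅ := congrFun hv i
    have h₆ := congrFun hv j
    simp [hij] at h₅ h₆
    omega
  rcases le_or_gt (f i (A'.bundle j)) (f i (A'.bundle i)) with hle' | hlt
  · exact add_le_add (hG hle) (hG hle')
  · obtain ⟨hij, v, hv, hvi⟩ := hreal'.exists_transfer hf hlt
    have h₁ := le_of_add_priorityOffset_le (hx'.transfer v j i hv hvi)
    have h₃ := (hf i).le_card (A'.bundle j)
    have h₄ : #(A'.bundle i) < #(A'.bundle j) := by
      rw [(hreal' i).1] at hlt
      exact_mod_cast hlt.trans_le h₃
    have h₅ := congrFun hv i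
    have h₆ := congrFun hv j
    simp [hij] at h₅ h₆
    rw [hv] at hx'
    obtain ⟨hi, hj⟩ := hx.swap hσ hf hx' hvi (by omega)
    have hcross : f i (A'.bundle j) ≤ f i (A.bundle i) := by
      rw [(hreal i).1]
      refine h₃.trans ?_
      exact_mod_cast (by omega : #(A'.bundle j) ≤ #(A.bundle i))
    have hcross' : f i (A.bundle j) ≤ f i (A'.bundle i) := by
      rw [(hreal' i).1]
      refine ((hf i).le_card _).trans ?_
      exact_mod_cast (by omega : #(A.bundle j) ≤ #(A'.bundle i))
    linarith [hG hcross, hG hcross']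

/-- Under a uniformly random priority order, the value of the own bundle stochastically dominates
the value of any other bundle. The priority orders are paired by exchanging `i` and `j`. -/
lemma sum_comp_le_sum_comp (hf : ∀ k, IsSubmodularDichotomous (f k))
    {A : Equiv.Perm (Fin n) → Allocation n M} (hA : ∀ σ, IsPEAllocation σ f (A σ)) (i j : Fin n)
    {G : ℝ → ℝ} (hG : Monotone G) :
    ∑ σ, G (f i ((A σ).bundle j)) ≤ ∑ σ, G (f i ((A σ).bundle i)) := by
  by_cases hij : i = j
  · rw [hij]
  have hdouble : ∀ ψ : Equiv.Perm (Fin n) → ℝ,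
      ∑ σ, (ψ σ + ψ (σ * Equiv.swap i j)) = 2 * ∑ σ, ψ σ := by
    intro ψ
    rw [sum_add_distrib, two_mul]
    congr 1
    exact Equiv.sum_comp (Equiv.mulRight (Equiv.swap i j)) ψ
  have h : ∀ σ, G (f i ((A σ).bundle j)) + G (f i ((A (σ * Equiv.swap i j)).bundle j)) ≤
      G (f i ((A σ).bundle i)) + G (f i ((A (σ * Equiv.swap i j)).bundle i)) := by
    intro σ
    rcases lt_or_gt_of_ne (σ.injective.ne hij) with hlt | hlt
    · exact (hA σ).add_le_add_of_swap hlt hf (hA _) hG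
    · have h := (hA (σ * Equiv.swap i j)).add_le_add_of_swap (i := i) (j := j) (A' := A σ)
        (by simpa using hlt) hf (by simpa using hA σ) hG
      linarith
  have := sum_le_sum fun σ (_ : σ ∈ univ) => h σ
  rw [hdouble fun σ => G (f i ((A σ).bundle j)), hdouble fun σ => G (f i ((A σ).bundle i))] at this
  linarith

variable {PE : Equiv.Perm (Fin n) → Mechanism n M} {r : Fin n → Report M}

omit [DecidableEq M] in
lemma expectation_randomPriority [Fintype M] (X : Allocation n M → ℝ) :
    expectation (randomPriority PE r) X =
      (∑ σ, X (PE σ r)) / Fintype.card (Equiv.Perm (Fin n)) := by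
  classical
  have h : ∀ A, (randomPriority PE r A).toReal =
      ∑ σ, if A = PE σ r then (Fintype.card (Equiv.Perm (Fin n)) : ℝ)⁻¹ else 0 := by
    intro A
    rw [randomPriority, PMF.map_apply, tsum_fintype, ENNReal.toReal_sum]
    · refine sum_congr rfl fun σ _ => ?_
      split_ifs <;> simp
    · intro σ _
      split_ifs <;> simp
  simp only [expectation, h, sum_mul]
  rw [sum_comm, sum_div]
  refine sum_congr rfl fun σ _ => ?_
  simp [ite_mul, div_eq_inv_mul]

lemma isStochasticallyEnvyFree_randomPriority (hf : ∀ k, IsSubmodularDichotomous (f k))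
    (hPE : ∀ σ, IsPEAllocation σ f (PE σ r)) :
    IsStochasticallyEnvyFree f (randomPriority PE r) := by
  classical
  intro i j t
  have hG : Monotone fun s : ℝ => if t ≤ s then (1 : ℝ) else 0 := by
    intro s s' hs
    dsimp only
    split_ifs with h h' <;> try norm_num
    exact h' (h.trans hs)
  have h := sum_comp_le_sum_comp hf hPE i j hG
  simp only [sum_boole, Nat.cast_le] at h
  rw [randomPriority, PMF.toOuterMeasure_map_apply, PMF.toOuterMeasure_map_apply,
    PMF.toOuterMeasure_uniformOfFintype_apply, PMF.toOuterMeasure_uniformOfFintype_apply]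
  refine ENNReal.div_le_div_right (Nat.cast_le.2 ?_) _
  rwa [← Set.toFinset_card, ← Set.toFinset_card, Set.preimage_ofPred_eq, Set.preimage_ofPred_eq,
    Set.toFinset_ofPred, Set.toFinset_ofPred]

lemma isExAnteEnvyFree_randomPriority [Fintype M] (hf : ∀ k, IsSubmodularDichotomous (f k))
    (hPE : ∀ σ, IsPEAllocation σ f (PE σ r)) : IsExAnteEnvyFree f (randomPriority PE r) := by
  intro i j
  rw [expectation_randomPriority, expectation_randomPriority]
  exact div_le_div_of_nonneg_right (sum_comp_le_sum_comp hf hPE i j monotone_id) (by positivity)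

end Envy

/-! ### Fairness of the realized allocations -/

section ExPost

variable {M : Type*} [DecidableEq M] {n : ℕ} {f : Fin n → Finset M → ℝ} {ε : Fin n → ℝ}
  {x : Fin n → ℕ}

/-- If `i` envies `j` in an egalitarian allocation, then `j` has at most one item more. -/
lemma IsOptimal.card_le_of_envy (hf : ∀ k, IsSubmodularDichotomous (f k)) (hx : IsOptimal f 0 x)
    {A : Allocation n M} (hA : Realizes f A x) {i j : Fin n}
    (hij : f i (A.bundle i) < f i (A.bundle j)) : #(A.bundle j) ≤ x i + 1 := by
  obtain ⟨hne, v, hv, hvi⟩ := hA.exists_transfer hf hij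
  have h : v j ≤ v i := by simpa using hx.transfer v j i hv hvi
  have h₁ := congrFun hv i
  have h₂ := congrFun hv j
  simp [hne] at h₁ h₂
  rw [(hA j).2]
  omega

lemma IsOptimal.isEFX (hf : ∀ k, IsSubmodularDichotomous (f k)) (hx : IsOptimal f 0 x)
    {A : Allocation n M} (hA : Realizes f A x) : IsEFX f A := by
  intro i j
  rcases le_or_gt (f i (A.bundle j)) (f i (A.bundle i)) with h | h
  · exact Or.inl h
  · refine Or.inr fun e he => ((hf i).le_card _).trans ?_
    have h₁ := hx.card_le_of_envy hf hA h
    have h₂ := card_sdiff_add_card_eq_card (singleton_subset_iff.2 he)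
    rw [card_singleton] at h₂
    rw [(hA i).1]
    exact_mod_cast (by omega : #(A.bundle j \ {e}) ≤ x i)

/-- Unallocated items have no marginal value, so subadditivity bounds the value of all items. -/
lemma IsOptimal.apply_univ_le_sum [Fintype M] (hf : ∀ k, IsSubmodularDichotomous (f k))
    (hx : IsOptimal f ε x) {A : Allocation n M} (hA : Realizes f A x) (i : Fin n) :
    f i univ ≤ ∑ j, f i (A.bundle j) := by
  refine le_trans (le_of_eq ?_) ((hf i).biUnion_le_sum univ A.bundle)
  rw [← (hf i).union_eq_of_forall (S := univ.biUnion A.bundle) (T := univ)]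
  · rw [union_eq_right.2 (subset_univ _)]
  intro e _
  by_cases he : ∃ j, e ∈ A.bundle j
  · obtain ⟨j, hj⟩ := he
    rw [union_eq_left.2 (singleton_subset_iff.2 (mem_biUnion.2 ⟨j, mem_univ j, hj⟩))]
  · push Not at he
    have h₁ := (hf i).submodular _ _ (subset_biUnion_of_mem A.bundle (mem_univ i)) e
    rcases (hf i).union_singleton_eq (A.bundle i) e with h | h
    · have := (hf i).valuation.mono _ _
        (subset_union_left (s₁ := univ.biUnion A.bundle) (s₂ := {e}))
      linarith
    · exact absurd ⟨_, hA.give_of_unallocated h he⟩ (hx.maximal i)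

lemma IsAdditive.biUnion_eq_sum {g : Finset M → ℝ} (hg : IsAdditive g)
    (h₀ : g ∅ = 0) {ι : Type*} [DecidableEq ι] (s : Finset ι) (B : ι → Finset M)
    (hB : ∀ i j, i ≠ j → Disjoint (B i) (B j)) : g (s.biUnion B) = ∑ i ∈ s, g (B i) := by
  induction s using Finset.induction_on with
  | empty => simpa using h₀
  | insert i s hi ih =>
    rw [biUnion_insert, sum_insert hi, ← ih, hg]
    exact (disjoint_biUnion_right _ _ _).2 fun j hj => hB i j fun h => hi (h ▸ hj)

lemma IsOptimal.isMaximinFair [Fintype M] (hf : ∀ k, IsSubmodularDichotomous (f k))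
    (hx : IsOptimal f 0 x) {A : Allocation n M} (hA : Realizes f A x)
    (hadd : ∀ k, IsAdditive (f k)) : IsMaximinFair f A := by
  intro i
  rw [(hA i).1]
  refine Real.iSup_le (fun ⟨P, hP⟩ => ?_) (Nat.cast_nonneg _)
  suffices h : ∃ j, f i (P.bundle j) < x i + 1 by
    obtain ⟨j, hj⟩ := h
    refine (ciInf_le (Set.finite_range _).bddBelow j).trans ?_
    obtain ⟨k, hk⟩ := (hf i).exists_nat (P.bundle j)
    rw [hk] at hj ⊢
    exact_mod_cast Nat.lt_succ_iff.1 (by exact_mod_cast hj)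
  by_contra! h
  have hPuniv : univ.biUnion P.bundle = univ :=
    eq_univ_of_forall fun a => mem_biUnion.2 ((hP a).imp fun j hj => ⟨mem_univ j, hj⟩)
  have h₁ := (hadd i).biUnion_eq_sum (hf i).valuation.normalized univ P.bundle P.disjoint
  rw [hPuniv] at h₁
  have h₂ := hx.apply_univ_le_sum hf hA i
  have h₃ : ∑ j, f i (A.bundle j) < ∑ j, f i (P.bundle j) := by
    refine sum_lt_sum (fun j _ => le_trans ?_ (h j)) ⟨i, mem_univ i, lt_of_lt_of_le ?_ (h i)⟩
    · rcases le_or_gt (f i (A.bundle j)) (f i (A.bundle i)) with h | h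
      · rw [(hA i).1] at h
        linarith
      · exact ((hf i).le_card _).trans (by exact_mod_cast hx.card_le_of_envy hf hA h)
    · rw [(hA i).1]
      linarith
  linarith

lemma isExAnteProportional_randomPriority [Fintype M] (hf : ∀ k, IsSubmodularDichotomous (f k))
    {PE : Equiv.Perm (Fin n) → Mechanism n M} {r : Fin n → Report M}
    (hPE : ∀ σ, IsPEAllocation σ f (PE σ r)) : IsExAnteProportional f (randomPriority PE r) := by
  intro i
  have hn : (0 : ℝ) < n := by exact_mod_cast i.pos
  have hN : (0 : ℝ) < Fintype.card (Equiv.Perm (Fin n)) := by exact_mod_cast Fintype.card_pos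
  have h₁ : ∑ j, expectation (randomPriority PE r) (fun A => f i (A.bundle j)) ≤
      n * expectation (randomPriority PE r) (fun A => f i (A.bundle i)) := by
    refine (sum_le_sum fun j _ => isExAnteEnvyFree_randomPriority hf hPE i j).trans_eq ?_
    simp
  have h₂ : f i univ ≤
      ∑ j, expectation (randomPriority PE r) (fun A => f i (A.bundle j)) := by
    simp only [expectation_randomPriority]
    rw [← sum_div, sum_comm, le_div_iff₀ hN]
    have := card_nsmul_le_sum univ (fun σ => ∑ j, f i ((PE σ r).bundle j)) (f i univ)
      fun σ _ => ((hPE σ).isOptimal hf).apply_univ_le_sum hf ((hPE σ).1.realizes hf) i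
    rwa [nsmul_eq_mul, mul_comm, card_univ] at this
  rw [div_le_iff₀ hn]
  linarith

end ExPost

end FairDivision

/-- The PE mechanism may pick any of the outcomes that its rule admits; the first part says that
there always is one, and the rest holds for every way to pick. -/
theorem mainTheorem3 {M : Type*} [Fintype M] [DecidableEq M] (n : ℕ) (hn : 2 ≤ n) :
    (∃ PE : Equiv.Perm (Fin n) → Mechanism n M, ∀ σ, IsPEMechanism σ (PE σ)) ∧
    ∀ PE : Equiv.Perm (Fin n) → Mechanism n M, (∀ σ, IsPEMechanism σ (PE σ)) →
      -- universally truthful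
      (∀ σ, (PE σ).IsTruthful) ∧
      -- when the agents report their valuations `f` truthfully
      ∀ f : Fin n → Finset M → ℝ, (∀ i, IsSubmodularDichotomous (f i)) →
        (∀ A ∈ (randomPriority PE fun i => some (f i)).support,
          IsWelfareMaximizing f A ∧ IsLorenzDominating f A ∧ IsNSWMaximizing f A ∧ IsEFX f A ∧
          ((∀ i, IsAdditive (f i)) → IsMaximinFair f A)) ∧
        IsStochasticallyEnvyFree f (randomPriority PE fun i => some (f i)) ∧
        IsExAnteEnvyFree f (randomPriority PE fun i => some (f i)) ∧
        IsExAnteProportional f (randomPriority PE fun i => some (f i)) := by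
  have hleg : ∀ (r : Fin n → Report M) (i : Fin n), IsSubmodularDichotomous (legalized (r i)) :=
    fun r i => isSubmodularDichotomous_legalized (r i)
  refine ⟨?_, fun PE hPE => ⟨fun σ => (hPE σ).isTruthful, fun f hf => ?_⟩⟩
  · choose PE hPE using fun σ (r : Fin n → Report M) => exists_isPEAllocation (hleg r) σ
    exact ⟨PE, hPE⟩
  have hPEf : ∀ σ, IsPEAllocation σ f (PE σ fun i => some (f i)) := by
    intro σ
    have h := hPE σ fun i => some (f i)
    simpa only [legalized_some (hf _)] using h
  refine ⟨fun A hA => ?_, isStochasticallyEnvyFree_randomPriority hf hPEf,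
    isExAnteEnvyFree_randomPriority hf hPEf, isExAnteProportional_randomPriority hf hPEf⟩
  obtain ⟨σ, -, rfl⟩ := (PMF.mem_support_map_iff _ _ _).1 hA
  have hreal := (hPEf σ).1.realizes hf
  have hopt := ((hPEf σ).isOptimal hf).drop_offsets (priorityOffset_lt_add_one σ σ)
  exact ⟨hopt.isWelfareMaximizing hf hreal, hopt.isLorenzDominating hf hreal,
    hopt.isNSWMaximizing hf hreal, hopt.isEFX hf hreal, hopt.isMaximinFair hf hreal⟩
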